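/- Let $I=[0,1]$ and let $K\subset[0,1]$ be the middle third Cantor set. For a finite binary string $a$ let $K_a\subset K$ be the corresponding similar copy of $K$: $K_\varnothing=K$, $K_{0a}=\tfrac13K_a$ and $K_{1a}=\tfrac13K_a+\tfrac23$; thus $K_{a0}$ and $K_{a1}$ are the left and right similar copies inside $K_a$. For $n\ge1$ let $J_n$ be the set of heights $\sum_{i=1}^n m_i3^{-i}$ with $m_i\in\{0,1,2\}$ and $m_n>0$. Let $\sim$ be the equivalence relation on $I\times K$ generated by $(x_1,x_2)\sim(x_1,x_2+2/3^n)$ whenever $n\ge1$, $x_1\in J_n$ and $x_2\in K_{a0}$ for some binary string $a$ of length $n-1$. Laakso space is the quotient $F=(I\times K)/\!\sim$ with quotient map $q(x_1,x_2)=[x_1,x_2]$, height $h\colon F\to I$, $h[x_1,x_2]=x_1$, and distance $$d(x,y)=\inf\{\mathcal H^1(P): P\subset I\times K,\ q(P)\text{ is a path joining }x\text{ and }y\},$$ where $\mathcal H^1$ is the one-dimensional Hausdorff measure in the plane, and paths are images of continuous maps from $[0,1]$ into $F$ with the quotient topology. A function $f\colon F\to\mathbb R$ is differentiable at $x\in F$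 if there is $D\in\mathbb R$ such that $$\lim_{y\to x}\frac{f(y)-f(x)-D\,(h(y)-h(x))}{d(y,x)}=0 ,$$ the limit being taken with respect to $d$ over $y\ne x$. A set $P\subset F$ is porous if there is $0<\rho<1$ such that for all $x\in P$ and $\delta>0$ there is $y\in F$ with $0<d(y,x)<\delta$ and $\{z\in F: d(z,y)<\rho\,d(y,x)\}\cap P=\varnothing$; a set is $\sigma$-porous if it is a countable union of porous sets. Theorem. Let $p\in F$, let $d_p(y)=d(y,p)$, and let $B_p\subset F$ be the set of points at which $d_p$ is not differentiable. Then $h(B_p)$ is countable, and $B_p$ is $\sigma$-porous. -/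

import Mathlib

open scoped ENNReal Topology unitInterval MeasureTheory

noncomputable section

namespace Laakso

/-- The strip `I × K`, where `I = [0,1]` and `K` is the middle third Cantor set. -/
abbrev Strip : Type := unitInterval × cantorSet

/-- The copy `K_a` of the Cantor set attached to a finite binary string `a`: the first letter of
the string chooses the left or the right third, so that `K_{a0}` and `K_{a1}` are the left and the
right similar copies inside `K_a`. -/
def cantorPiece : List (Fin 2) → Set ℝ
  | [] => cantorSet
  | i :: a => (fun x : ℝ => x / 3 + 2 * ((i : ℕ) : ℝ) / 3) '' cantorPiece a

/-- The heights `w(m₁, …, mₙ) = ∑ mᵢ / 3^i`, with `mᵢ ∈ {0,1,2}` and `mₙ > 0`, of the wormhole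
levels of order `n` (there are none for `n = 0`). -/
def wormholeHeights (n : ℕ) : Set ℝ :=
  {t | ∃ m : Fin n → Fin 3, (∃ i : Fin n, (i : ℕ) + 1 = n ∧ 0 < m i) ∧
    t = ∑ i : Fin n, (((m i : Fin 3) : ℕ) : ℝ) / 3 ^ ((i : ℕ) + 1)}

/-- The basic identification: at a wormhole level of order `n`, the point `(x₁, x₂)` with
`x₂ ∈ K_{a0}`, `a` a binary string of length `n - 1`, is identified with
`(x₁, x₂ + 2 / 3^n)`. -/
def Identified (x y : Strip) : Prop :=
  x.1 = y.1 ∧ ∃ (n : ℕ) (a : List (Fin 2)), a.length + 1 = n ∧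
    (x.1 : ℝ) ∈ wormholeHeights n ∧ (x.2 : ℝ) ∈ cantorPiece (a ++ [0]) ∧
    (y.2 : ℝ) = (x.2 : ℝ) + 2 / 3 ^ n

/-- The equivalence relation on the strip generated by the identifications. -/
def stripSetoid : Setoid Strip := Relation.EqvGen.setoid Identified

/-- Laakso space as a set: the quotient `F = (I × K) / ∼`. -/
def Space : Type := Quotient stripSetoid

/-- `F` carries the quotient topology; paths in `F` are continuous with respect to it. -/
instance : TopologicalSpace Space :=
  inferInstanceAs (TopologicalSpace (Quotient stripSetoid))

/-- The quotient map `q (x₁, x₂) = [x₁, x₂]`. -/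
def proj (x : Strip) : Space := Quotient.mk stripSetoid x

theorem eqvGen_fst_eq {x y : Strip} (h : Relation.EqvGen Identified x y) : x.1 = y.1 := by
  induction h with
  | rel _ _ h => exact h.1
  | refl _ => rfl
  | symm _ _ _ ih => exact ih.symm
  | trans _ _ _ _ _ ih₁ ih₂ => exact ih₁.trans ih₂

/-- The height `h [x₁, x₂] = x₁`. -/
def height : Space → unitInterval :=
  Quotient.lift (fun x : Strip => x.1) (fun _ _ h => eqvGen_fst_eq h)

/-- The inclusion of the strip in the Euclidean plane. -/
def toPlane (x : Strip) : EuclideanSpace ℝ (Fin 2) := !₂[(x.1 : ℝ), (x.2 : ℝ)]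

/-- The infimum of the one-dimensional Hausdorff measures of the sets `P ⊆ I × K` whose image
`q(P)` is (the image of) a path from `x` to `y`, as an extended number. -/
def edist (x y : Space) : ℝ≥0∞ :=
  ⨅ (P : Set Strip) (_ : ∃ γ : Path x y, Set.range γ = proj '' P), μH[1] (toPlane '' P)

/-- The Laakso distance. Any two points are joined by a path of finite length, so `edist` is
finite and nothing is lost in passing to real numbers. -/
def dist (x y : Space) : ℝ := (edist x y).toReal

/-- `f` is differentiable at `x` (with respect to the height): for some real number `D`,
`(f y - f x - D (h y - h x)) / d(y, x) → 0` as `y → x`, `y ≠ x`, in the distance `d`. -/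
def DifferentiableAt (f : Space → ℝ) (x : Space) : Prop :=
  ∃ D : ℝ, ∀ ε > 0, ∃ δ > 0, ∀ y : Space, 0 < dist y x → dist y x < δ →
    |(f y - f x - D * ((height y : ℝ) - (height x : ℝ))) / dist y x| < ε

/-- The set `B_p` of points at which the distance `y ↦ d(y, p)` from `p` is not
differentiable. -/
def nonDiffSet (p : Space) : Set Space :=
  {x | ¬ DifferentiableAt (fun y => dist y p) x}

/-- A set `P` is porous for the distance function `d`: for some `0 < ρ < 1`, arbitrarily close to
each `x ∈ P` there is a point `y ≠ x` such that the open ball of radius `ρ d(y, x)` about `y`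
misses `P`. -/
def IsPorous {X : Type*} (d : X → X → ℝ) (P : Set X) : Prop :=
  ∃ ρ : ℝ, 0 < ρ ∧ ρ < 1 ∧ ∀ x ∈ P, ∀ δ > 0, ∃ y : X, 0 < d y x ∧ d y x < δ ∧
    {z | d z y < ρ * d y x} ∩ P = ∅

/-- A set is `σ`-porous if it is a countable union of porous sets. -/
def IsSigmaPorous {X : Type*} (d : X → X → ℝ) (P : Set X) : Prop :=
  ∃ A : ℕ → Set X, (∀ n, IsPorous d (A n)) ∧ P = ⋃ n, A n

end Laakso

end

/-!
The proof rests on a formula for the Laakso distance (`Spans.dist_le`, `exists_spans_cost_lt`).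
Write points of the Cantor set by their binary digits; a wormhole level of order `n + 1` allows a
path to change the digit with index `n` and no other. Between two points at heights `s` and `t`
the distance is the infimum of `2 * (b - a) - |s - t|` over the intervals `[a, b]` that contain
both heights and, for each digit in which the points differ, a wormhole level at which it can be
changed.

For the upper bound, move vertically to height `a`, climb to `b` while switching all digits that
have to be switched, and move vertically to the other point. The climb is continuous in the
quotient even if it makes infinitely many switches (`continuous_proj_switch`), and its lift to the
strip is a curve of unit speed with jumps, whose image has length `b - a`
(`hausdorffMeasure_image_Icc_le_of_jumps`). For the lower bound, a path that visits some height
outside `[s, t]` in one point only can be cut there and stays connected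
(`IsPreconnected.inter_le_of_subsingleton`), and a connected set joining points with different
digits has to meet the corresponding wormhole levels (`exists_height_mem_wormholeHeights`). So on
the part of a spanning interval outside `[s, t]` all fibres of the path have two points, and its
length counts this part twice (`volume_add_volume_le_hausdorffMeasure`).

Now let `p` be at height `q` and let `x` be at a height `t₀` that is not a rational combination of
`1` and `q`; this excludes countably many heights. Intervals containing `t₀` and `q` contain
wormhole levels of all high orders, so only finitely many digits matter, and these are constant
near `x`. The endpoints of an optimal interval are then the height itself, or `q`, or one of
finitely many wormhole levels. Near `x` the distance from `p` is therefore the minimum of finitely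
many affine functions of the height with rational slopes, whose constants are rational
combinations of `1` and `q`; two of them with different slopes cannot agree at `t₀`. Hence the
distance is an affine function of the height near `x`, and differentiable at `x`.

This shows that the heights of the exceptional points are countable. Porosity follows, since a set
of points at one height is porous: a point at vertical distance `r` from it is the centre of a
ball of radius `r` that misses the set.
-/

/-! ### Connected sets cut at a level -/

/-- Cutting a connected set at a level that it meets at most once leaves it connected. -/
theorem IsPreconnected.inter_le_of_subsingleton {X : Type*} [TopologicalSpace X]
    {S : Set X} (hS : IsPreconnected S) {f : X → ℝ} (hf : Continuous f) {t : ℝ}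
    (ht : (S ∩ {x | f x = t}).Subsingleton) : IsPreconnected (S ∩ {x | t ≤ f x}) := by
  rw [isPreconnected_closed_iff]
  intro A B hA hB hAB hSA hSB
  wlog hz : ∀ z ∈ S, f z = t → z ∈ A generalizing A B
  · push Not at hz
    obtain ⟨z, hzS, hzt, hzA⟩ := hz
    have hzB : z ∈ B := (hAB ⟨hzS, hzt.ge⟩).resolve_left hzA
    rw [Set.inter_comm A B]
    refine this B A hB hA (by rwa [Set.union_comm]) hSB hSA fun w hw hwt => ?_
    rwa [ht ⟨hw, hwt⟩ ⟨hzS, hzt⟩]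
  have hge : IsClosed {x | t ≤ f x} := isClosed_le continuous_const hf
  have hle : IsClosed {x | f x ≤ t} := isClosed_le hf continuous_const
  obtain ⟨a, ⟨haS, hat⟩, haA⟩ := hSA
  obtain ⟨b, ⟨hbS, hbt⟩, hbB⟩ := hSB
  obtain ⟨w, hwS, hwA, hwB, hwt⟩ := isPreconnected_closed_iff.1 hS (A ∪ {x | f x ≤ t})
    (B ∩ {x | t ≤ f x}) (hA.union hle) (hB.inter hge) (fun x hx => by
      rcases le_total (f x) t with h | h
      · exact Or.inl (Or.inr h)
      · rcases hAB ⟨hx, h⟩ with h' | h'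
        · exact Or.inl (Or.inl h')
        · exact Or.inr ⟨h', h⟩)
    ⟨a, haS, Or.inl haA⟩ ⟨b, hbS, hbB, hbt⟩
  refine ⟨w, ⟨hwS, hwt⟩, ?_, hwB⟩
  rcases hwA with h | h
  · exact h
  · exact hz w hwS (le_antisymm h hwt)

theorem IsPreconnected.inter_ge_of_subsingleton {X : Type*} [TopologicalSpace X]
    {S : Set X} (hS : IsPreconnected S) {f : X → ℝ} (hf : Continuous f) {t : ℝ}
    (ht : (S ∩ {x | f x = t}).Subsingleton) : IsPreconnected (S ∩ {x | f x ≤ t}) := by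
  have h := hS.inter_le_of_subsingleton hf.neg (t := -t) (by simpa [neg_inj] using ht)
  simpa using h

/-! ### Counting multiplicities, and curves with jumps -/

namespace MeasureTheory

/-- A finite family of sets, counted with multiplicity, covers the points that lie in two of its
members twice. The sets need not be measurable. -/
theorem measure_iUnion_add_le_sum {X ι : Type*} [MeasurableSpace X] [Fintype ι] (μ : Measure X)
    (A : ι → Set X) :
    μ (⋃ i, A i) + μ {x | ∃ i j, i ≠ j ∧ x ∈ A i ∧ x ∈ A j} ≤ ∑ i, μ (A i) := by
  classical
  let H (i : ι) := toMeasurable μ (A i)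
  have hH (i : ι) : MeasurableSet (H i) := measurableSet_toMeasurable _ _
  let G : Set X := ⋃ i, ⋃ j, ⋃ _ : i ≠ j, H i ∩ H j
  have hG : MeasurableSet G := MeasurableSet.iUnion fun i => MeasurableSet.iUnion fun j =>
    MeasurableSet.iUnion fun _ => (hH i).inter (hH j)
  have hU : MeasurableSet (⋃ i, H i) := MeasurableSet.iUnion hH
  calc μ (⋃ i, A i) + μ {x | ∃ i j, i ≠ j ∧ x ∈ A i ∧ x ∈ A j}
      ≤ μ (⋃ i, H i) + μ G := by
        refine add_le_add (measure_mono (Set.iUnion_mono fun i => subset_toMeasurable _ _))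
          (measure_mono ?_)
        rintro x ⟨i, j, hij, hi, hj⟩
        simp only [G, Set.mem_iUnion]
        exact ⟨i, j, hij, subset_toMeasurable _ _ hi, subset_toMeasurable _ _ hj⟩
    _ = ∫⁻ x, (⋃ i, H i).indicator 1 x + G.indicator 1 x ∂μ := by
        rw [lintegral_add_left (measurable_one.indicator hU), lintegral_indicator_one hU,
          lintegral_indicator_one hG]
    _ ≤ ∫⁻ x, ∑ i, (H i).indicator 1 x ∂μ := by
        refine lintegral_mono fun x => ?_
        by_cases hx : x ∈ G
        · have hx' := hx
          simp only [G, Set.mem_iUnion] at hx'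
          obtain ⟨i, j, hij, hi, hj⟩ := hx'
          have hxU : x ∈ ⋃ i, H i := Set.mem_iUnion.2 ⟨i, hi⟩
          calc (⋃ i, H i).indicator 1 x + G.indicator 1 x
              = (H i).indicator 1 x + (H j).indicator (1 : X → ℝ≥0∞) x := by
                simp [hx, hxU, hi, hj]
            _ = ∑ k ∈ {i, j}, (H k).indicator 1 x := 
                (Finset.sum_pair (f := fun k => (H k).indicator (1 : X → ℝ≥0∞) x) hij).symm
            _ ≤ _ := Finset.sum_le_sum_of_subset (Finset.subset_univ _)
        · by_cases hxU : x ∈ ⋃ i, H i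
          · obtain ⟨i, hi⟩ := Set.mem_iUnion.1 hxU
            calc (⋃ i, H i).indicator 1 x + G.indicator 1 x
                = (H i).indicator (1 : X → ℝ≥0∞) x := by simp [hx, hxU, hi]
              _ ≤ _ := Finset.single_le_sum (f := fun i => (H i).indicator (1 : X → ℝ≥0∞) x)
                (fun _ _ => zero_le) (Finset.mem_univ i)
          · rw [Set.indicator_of_notMem hx, Set.indicator_of_notMem hxU, add_zero]
            exact zero_le
    _ = ∑ i, μ (A i) := by
        rw [lintegral_finsetSum _ fun i _ => measurable_one.indicator (hH i)]
        refine Finset.sum_congr rfl fun i _ => ?_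
        rw [lintegral_indicator_one (hH i), measure_toMeasurable]

/-- A curve that moves at unit speed except for countably many jumps, at the times `c n` and of
size at most `w n`, has an image of length at most the duration: it is a `1`-Lipschitz image of a
set of reals that misses gaps of the same sizes as the jumps. -/
theorem hausdorffMeasure_image_Icc_le_of_jumps {X : Type*} [MetricSpace X] [MeasurableSpace X]
    [BorelSpace X] {Φ : ℝ → X} {c w : ℕ → ℝ} (hw : ∀ n, 0 ≤ w n) (hs : Summable w) {a b : ℝ}
    (hab : a ≤ b) (hc : ∀ n, w n ≠ 0 → c n ∈ Set.Icc a b)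
    (hinj : ∀ m n, w m ≠ 0 → w n ≠ 0 → c m = c n → m = n)
    (hΦ : ∀ s t, a ≤ s → s ≤ t → t ≤ b →
      dist (Φ s) (Φ t) ≤ (t - s) + ∑' n, if s < c n ∧ c n ≤ t then w n else 0) :
    μH[1] (Φ '' Set.Icc a b) ≤ ENNReal.ofReal (b - a) := by
  have hsum (p : ℕ → Prop) [DecidablePred p] : Summable fun n => if p n then w n else 0 := by
    refine Summable.of_nonneg_of_le (fun n => ?_) (fun n => ?_) hs
    · split_ifs <;> simp [hw]
    · split_ifs <;> simp [hw]
  let τ (s : ℝ) : ℝ := s + ∑' n, if c n ≤ s then w n else 0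
  have hτ {s t : ℝ} (hst : s ≤ t) :
      τ t - τ s = (t - s) + ∑' n, if s < c n ∧ c n ≤ t then w n else 0 := by
    have h : (∑' n, if c n ≤ t then w n else 0) =
        (∑' n, if c n ≤ s then w n else 0) + ∑' n, if s < c n ∧ c n ≤ t then w n else 0 := by
      rw [← (hsum _).tsum_add (hsum _)]
      refine tsum_congr fun n => ?_
      by_cases h1 : c n ≤ s
      · simp [h1, h1.trans hst, not_lt.2 h1]
      · simp [h1, not_le.1 h1]
    simp only [τ]
    rw [h]
    ring
  have hτmono {s t : ℝ} (hst : s ≤ t) : t - s ≤ τ t - τ s := by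
    rw [hτ hst]
    have : 0 ≤ ∑' n, if s < c n ∧ c n ≤ t then w n else 0 :=
      tsum_nonneg fun n => by split_ifs <;> simp [hw]
    linarith
  have hτjump {s : ℝ} {n : ℕ} (hn : s < c n) : (c n - s) + w n ≤ τ (c n) - τ s := by
    rw [hτ hn.le]
    have := (hsum (fun m => s < c m ∧ c m ≤ c n)).le_tsum n
      (fun m _ => by split_ifs <;> simp [hw])
    simp only [hn, le_refl, and_self, if_true] at this
    linarith
  have hτinj : Function.Injective τ := by
    intro s t h
    rcases le_total s t with h' | h'
    · have := hτmono h'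
      linarith
    · have := hτmono h'
      linarith
  -- the curve factors through `τ` with Lipschitz constant `1`
  have hlip : LipschitzOnWith 1 (Φ ∘ Function.invFun τ) (τ '' Set.Icc a b) := by
    refine LipschitzOnWith.of_dist_le_mul ?_
    rintro _ ⟨s, hs, rfl⟩ _ ⟨t, ht, rfl⟩
    simp only [Function.comp_apply, Function.leftInverse_invFun hτinj _, NNReal.coe_one, one_mul]
    wlog hst : s ≤ t generalizing s t
    · rw [dist_comm, dist_comm (τ s)]
      exact this t ht s hs (le_of_not_ge hst)
    refine (hΦ s t hs.1 hst ht.2).trans ?_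
    rw [← hτ hst, Real.dist_eq, abs_sub_comm]
    exact le_abs_self _
  have h1 : μH[1] (Φ '' Set.Icc a b) ≤ volume (τ '' Set.Icc a b) := by
    have h := hlip.hausdorffMeasure_image_le (d := 1) zero_le_one
    rw [Set.image_image, hausdorffMeasure_real] at h
    simpa [Function.leftInverse_invFun hτinj _] using h
  refine h1.trans ?_
  -- the values of `τ` avoid these intervals, one just below each jump
  let gap (n : ℕ) : Set ℝ := Set.Ico (τ (c n) - w n) (τ (c n))
  have hgap {n : ℕ} {x : ℝ} (hx : x ∈ gap n) : w n ≠ 0 := by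
    intro h
    simp only [gap, h, sub_zero, Set.Ico_self] at hx
    exact hx
  have hdisj : Pairwise (Function.onFun Disjoint gap) := by
    intro m n hmn
    refine Set.disjoint_left.2 fun x hm hn => ?_
    wlog hlt : c m < c n generalizing m n
    · rcases (not_lt.1 hlt).eq_or_lt with h | h
      · exact hmn (hinj _ _ (hgap hm) (hgap hn) h.symm)
      · exact this hmn.symm hn hm h
    have := hτjump hlt
    have := hm.2
    have := hn.1
    linarith
  have hdisj' : Disjoint (τ '' Set.Icc a b) (⋃ n, gap n) := by
    refine Set.disjoint_left.2 ?_
    rintro _ ⟨s, -, rfl⟩ hx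
    obtain ⟨n, hn⟩ := Set.mem_iUnion.1 hx
    rcases lt_or_ge s (c n) with h | h
    · have := hτjump h
      have := hn.1
      linarith
    · have := hτmono h
      have := hn.2
      linarith
  have hτle {s : ℝ} : τ s ≤ s + ∑' n, w n := by
    have := (hsum fun n => c n ≤ s).tsum_le_tsum (fun n => by split_ifs <;> simp [hw]) hs
    simp only [τ]
    linarith
  have hleτ {s : ℝ} : s ≤ τ s := by
    have : 0 ≤ ∑' n, if c n ≤ s then w n else 0 :=
      tsum_nonneg fun n => by split_ifs <;> simp [hw]
    simp only [τ]
    linarith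
  have hsub : τ '' Set.Icc a b ∪ ⋃ n, gap n ⊆ Set.Icc a (b + ∑' n, w n) := by
    rintro x (⟨s, hs, rfl⟩ | hx)
    · exact ⟨hs.1.trans hleτ, hτle.trans (by linarith [hs.2])⟩
    · obtain ⟨n, hn⟩ := Set.mem_iUnion.1 hx
      have hcn := hc n (hgap hn)
      refine ⟨le_trans ?_ hn.1, hn.2.le.trans (hτle.trans (by linarith [hcn.2]))⟩
      have := (hsum (fun m => c m ≤ c n)).le_tsum n (fun m _ => by split_ifs <;> simp [hw])
      simp only [le_refl, if_true] at this
      simp only [τ]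
      linarith [hcn.1]
  have hgaps : volume (⋃ n, gap n) = ENNReal.ofReal (∑' n, w n) := by
    rw [measure_iUnion hdisj fun n => measurableSet_Ico, ENNReal.ofReal_tsum_of_nonneg hw hs]
    simp [gap]
  have htot : volume (τ '' Set.Icc a b) + ENNReal.ofReal (∑' n, w n) ≤
      ENNReal.ofReal (b - a) + ENNReal.ofReal (∑' n, w n) := by
    rw [← hgaps, ← measure_union hdisj' (MeasurableSet.iUnion fun n => measurableSet_Ico), hgaps,
      ← ENNReal.ofReal_add (by linarith) (tsum_nonneg hw)]
    refine (measure_mono hsub).trans ?_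
    rw [Real.volume_Icc]
    exact ENNReal.ofReal_le_ofReal (by linarith)
  exact (ENNReal.add_le_add_iff_right ENNReal.ofReal_ne_top).1 htot

end MeasureTheory

noncomputable section

namespace Laakso

open MeasureTheory

/-! ### Binary digits of points of the Cantor set -/

/-- The sequence of binary digits of a point of the Cantor set. The digit with index `n` is the
one that the identifications at the wormhole levels of order `n + 1` change. -/
def digits : cantorSet ≃ₜ (ℕ → Bool) := cantorSetHomeomorphNatToBool

/-- The point of the Cantor set with the binary digits `ε`, as a real number. -/
def ofBits (ε : ℕ → Bool) : ℝ := ∑' n, if ε n then 2 / 3 ^ (n + 1) else 0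

theorem hasSum_weights : HasSum (fun n : ℕ => (2 : ℝ) / 3 ^ (n + 1)) 1 := by
  have h := (hasSum_geometric_of_lt_one (r := (1 / 3 : ℝ)) (by norm_num) (by norm_num)).mul_left
    (2 / 3 : ℝ)
  have h' : (fun n : ℕ => (2 : ℝ) / 3 ^ (n + 1)) = fun n => 2 / 3 * (1 / 3) ^ n := by
    ext n
    rw [pow_succ, one_div, inv_pow]
    field_simp
  rwa [← h', show (2 / 3 : ℝ) * (1 - 1 / 3)⁻¹ = 1 by norm_num] at h

theorem summable_ite_weights (p : ℕ → Prop) [DecidablePred p] :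
    Summable (fun n : ℕ => if p n then (2 : ℝ) / 3 ^ (n + 1) else 0) := by
  refine Summable.of_nonneg_of_le (fun n => ?_) (fun n => ?_) hasSum_weights.summable
  · split_ifs <;> positivity
  · split_ifs
    · exact le_rfl
    · positivity

theorem coe_digits_symm (ε : ℕ → Bool) : ((digits.symm ε : cantorSet) : ℝ) = ofBits ε := by
  change Real.ofDigits (fun i => cond (ε i) (2 : Fin 3) 0) = ofBits ε
  unfold Real.ofDigits ofBits
  refine tsum_congr fun n => ?_
  cases h : ε n <;> simp [Real.ofDigitsTerm, h, div_eq_mul_inv]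

theorem ofBits_digits (k : cantorSet) : ofBits (digits k) = k := by
  rw [← coe_digits_symm, Homeomorph.symm_apply_apply]

theorem ofBits_injective : Function.Injective ofBits := fun ε ε' h => by
  rw [← coe_digits_symm, ← coe_digits_symm] at h
  exact digits.symm.injective (Subtype.ext h)

theorem abs_ofBits_sub_le (ε ε' : ℕ → Bool) :
    |ofBits ε - ofBits ε'| ≤ ∑' n, if ε n ≠ ε' n then (2 : ℝ) / 3 ^ (n + 1) else 0 := by
  unfold ofBits
  rw [← (summable_ite_weights (fun n => ε n = true)).tsum_sub
    (summable_ite_weights (fun n => ε' n = true)), ← Real.norm_eq_abs]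
  refine tsum_of_norm_bounded (summable_ite_weights (fun n => ε n ≠ ε' n)).hasSum fun n => ?_
  have : (0 : ℝ) < 2 / 3 ^ (n + 1) := by positivity
  cases h : ε n <;> cases h' : ε' n <;> simp

theorem ofBits_update_true {ε : ℕ → Bool} {n : ℕ} (h : ε n = false) :
    ofBits (Function.update ε n true) = ofBits ε + 2 / 3 ^ (n + 1) := by
  unfold ofBits
  rw [← tsum_ite_eq n (fun m : ℕ => (2 : ℝ) / 3 ^ (m + 1)),
    ← (summable_ite_weights (fun n => ε n = true)).tsum_add (summable_ite_weights (fun m => m = n))]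
  refine tsum_congr fun m => ?_
  by_cases hm : m = n
  · subst hm
    simp [h]
  · simp [hm]

theorem ofBits_eq_zero_add (ε : ℕ → Bool) :
    ofBits ε = ofBits (fun n => ε (n + 1)) / 3 + if ε 0 then 2 / 3 else 0 := by
  unfold ofBits
  rw [(summable_ite_weights (fun n => ε n = true)).tsum_eq_zero_add, ← tsum_div_const, add_comm]
  congr 1
  · refine tsum_congr fun n => ?_
    split_ifs
    · rw [pow_succ _ (n + 1)]
      field_simp
    · simp
  · simp

/-- The copy `K_a` consists of the points whose digits begin with `a`. -/
theorem mem_cantorPiece (a : List (Fin 2)) (x : ℝ) : x ∈ cantorPiece a ↔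
    ∃ ε : ℕ → Bool, (∀ (i : ℕ) (hi : i < a.length), ε i = decide (a[i] = 1)) ∧ x = ofBits ε := by
  induction a generalizing x with
  | nil =>
    constructor
    · intro hx
      exact ⟨digits ⟨x, hx⟩, by simp, (ofBits_digits ⟨x, hx⟩).symm⟩
    · rintro ⟨ε, -, rfl⟩
      rw [← coe_digits_symm]
      exact (digits.symm ε).2
  | cons j a ih =>
    constructor
    · rintro ⟨y, hy, rfl⟩
      obtain ⟨ε, hε, rfl⟩ := (ih y).1 hy
      refine ⟨fun n => Nat.casesOn n (decide (j = 1)) ε, ?_, ?_⟩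
      · intro i hi
        cases i with
        | zero => simp
        | succ i => simpa using hε i (by simpa using hi)
      · conv_rhs => rw [ofBits_eq_zero_add]
        fin_cases j <;> simp
    · rintro ⟨ε, hε, rfl⟩
      refine ⟨ofBits fun n => ε (n + 1), (ih _).2 ⟨_, fun i hi => ?_, rfl⟩, ?_⟩
      · have h := hε (i + 1) (by simpa using hi)
        rwa [List.getElem_cons_succ] at h
      · rw [ofBits_eq_zero_add ε, hε 0 (by simp)]
        fin_cases j <;> simp

/-- In terms of digits, the basic identification at order `n + 1` changes the digit with index `n`
from `0` to `1`. -/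
theorem identified_iff (x y : Strip) : Identified x y ↔ x.1 = y.1 ∧ ∃ n : ℕ,
    (x.1 : ℝ) ∈ wormholeHeights (n + 1) ∧ digits x.2 n = false ∧
      digits y.2 = Function.update (digits x.2) n true := by
  refine and_congr_right fun _ => ⟨?_, ?_⟩
  · rintro ⟨_, a, rfl, hx, ha, hy⟩
    obtain ⟨ε, hε, hxε⟩ := (mem_cantorPiece _ _).1 ha
    have hd : digits x.2 = ε := ofBits_injective (by rw [ofBits_digits, hxε])
    have h0 : digits x.2 a.length = false := by
      rw [hd, hε a.length (by simp)]
      simp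
    refine ⟨a.length, hx, h0, ofBits_injective ?_⟩
    rw [ofBits_update_true h0, ofBits_digits, ofBits_digits, hy]
  · rintro ⟨n, hx, h0, hy⟩
    refine ⟨n + 1, List.ofFn fun i : Fin n => if digits x.2 i then 1 else 0, by simp, hx,
      (mem_cantorPiece _ _).2 ⟨digits x.2, fun i hi => ?_, (ofBits_digits _).symm⟩, ?_⟩
    · have hi' : i < n + 1 := by simpa using hi
      rcases Nat.lt_succ_iff_lt_or_eq.1 hi' with h | rfl
      · rw [List.getElem_append_left (by simpa using h)]
        cases hb : digits x.2 i <;> simp [hb]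
      · rw [List.getElem_append_right (by simp)]
        simp [h0]
    · rw [← ofBits_digits y.2, hy, ofBits_update_true h0, ofBits_digits]

/-! ### Wormhole levels -/

theorem exists_digit_sum (n : ℕ) (k : ℕ) (hk : k < 3 ^ n) :
    ∃ m : Fin n → Fin 3,
      ∑ i : Fin n, (((m i : Fin 3) : ℕ) : ℝ) / 3 ^ ((i : ℕ) + 1) = k / 3 ^ n := by
  induction n generalizing k with
  | zero => exact ⟨Fin.elim0, by simp_all⟩
  | succ n ih =>
    obtain ⟨m, hm⟩ := ih (k / 3) (by rw [pow_succ] at hk; omega)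
    refine ⟨Fin.snoc m ⟨k % 3, Nat.mod_lt _ (by norm_num)⟩, ?_⟩
    rw [Fin.sum_univ_castSucc]
    simp only [Fin.snoc_castSucc, Fin.snoc_last, Fin.val_castSucc, Fin.val_last]
    rw [hm]
    have : (k : ℝ) = 3 * ((k / 3 : ℕ) : ℝ) + ((k % 3 : ℕ) : ℝ) := by
      exact_mod_cast (Nat.div_add_mod k 3).symm
    rw [this, pow_succ]
    field_simp

theorem digit_sum_eq (n : ℕ) (m : Fin n → Fin 3) :
    ∃ k < 3 ^ n, ∑ i : Fin n, (((m i : Fin 3) : ℕ) : ℝ) / 3 ^ ((i : ℕ) + 1) = (k : ℕ) / 3 ^ n := by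
  induction n with
  | zero => exact ⟨0, by simp⟩
  | succ n ih =>
    obtain ⟨k, hk, h⟩ := ih (fun i => m i.castSucc)
    refine ⟨3 * k + m (Fin.last n), by rw [pow_succ]; omega, ?_⟩
    rw [Fin.sum_univ_castSucc]
    simp only [Fin.val_castSucc, Fin.val_last]
    rw [h, pow_succ]
    push_cast
    field_simp

/-- The wormhole levels of order `n + 1` are the fractions `k / 3 ^ (n + 1)` in the unit interval
whose numerator is not a multiple of `3`. -/
theorem mem_wormholeHeights (n : ℕ) (t : ℝ) : t ∈ wormholeHeights (n + 1) ↔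
    ∃ k : ℕ, k < 3 ^ (n + 1) ∧ ¬ 3 ∣ k ∧ t = k / 3 ^ (n + 1) := by
  have key (m : Fin (n + 1) → Fin 3) {k : ℕ} (h : ∑ i, (((m i : Fin 3) : ℕ) : ℝ) /
      3 ^ ((i : ℕ) + 1) = k / 3 ^ (n + 1)) : k % 3 = m (Fin.last n) := by
    obtain ⟨j, -, hj⟩ := digit_sum_eq n (fun i => m i.castSucc)
    rw [Fin.sum_univ_castSucc] at h
    simp only [Fin.val_castSucc, Fin.val_last] at h
    rw [hj, pow_succ] at h
    have h' : ((3 * j + m (Fin.last n) : ℕ) : ℝ) = k := by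
      push_cast
      field_simp at h
      linarith
    have h'' : 3 * j + m (Fin.last n) = k := by exact_mod_cast h'
    omega
  constructor
  · rintro ⟨m, ⟨i, hi, hpos⟩, rfl⟩
    obtain ⟨k, hk, h⟩ := digit_sum_eq (n + 1) m
    refine ⟨k, hk, fun hdvd => ?_, h⟩
    obtain rfl : i = Fin.last n := Fin.ext (by simpa using hi)
    have := key m h
    have : (0 : ℕ) < m (Fin.last n) := hpos
    omega
  · rintro ⟨k, hk, hdvd, rfl⟩
    obtain ⟨m, hm⟩ := exists_digit_sum (n + 1) k hk
    refine ⟨m, ⟨Fin.last n, by simp, ?_⟩, hm.symm⟩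
    have := key m hm
    rw [← Fin.val_pos_iff]
    omega

theorem wormholeHeights_finite (n : ℕ) : (wormholeHeights n).Finite :=
  (Set.finite_range fun m : Fin n → Fin 3 =>
    ∑ i : Fin n, (((m i : Fin 3) : ℕ) : ℝ) / 3 ^ ((i : ℕ) + 1)).subset
    (by rintro t ⟨m, -, rfl⟩; exact ⟨m, rfl⟩)

theorem wormholeHeights_subset_Icc (n : ℕ) : wormholeHeights (n + 1) ⊆ Set.Icc 0 1 := by
  intro t ht
  obtain ⟨k, hk, -, rfl⟩ := (mem_wormholeHeights n t).1 ht
  refine ⟨by positivity, ?_⟩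
  rw [div_le_one (by positivity)]
  exact_mod_cast hk.le

theorem wormholeHeights_disjoint {m n : ℕ} {t : ℝ} (hm : t ∈ wormholeHeights (m + 1))
    (hn : t ∈ wormholeHeights (n + 1)) : m = n := by
  wlog h : m < n generalizing m n
  · rcases (not_lt.1 h).eq_or_lt with h | h
    · exact h.symm
    · exact (this hn hm h).symm
  obtain ⟨k, -, -, rfl⟩ := (mem_wormholeHeights m t).1 hm
  obtain ⟨l, -, hl, h'⟩ := (mem_wormholeHeights n _).1 hn
  refine absurd ?_ hl
  rw [div_eq_div_iff (by positivity) (by positivity)] at h'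
  obtain ⟨d, rfl⟩ := Nat.exists_eq_add_of_lt h
  have h2 : k * 3 ^ (m + d + 1 + 1) = l * 3 ^ (m + 1) := by exact_mod_cast h'
  have h3 : k * 3 ^ (d + 1) * 3 ^ (m + 1) = l * 3 ^ (m + 1) := by rw [← h2]; ring
  have h4 := Nat.eq_of_mul_eq_mul_right (by positivity) h3
  exact ⟨k * 3 ^ d, by rw [← h4]; ring⟩

/-- Every interval of length at least `2 / 3 ^ (n + 1)` meets the wormhole levels of order
`n + 1`. -/
theorem exists_wormhole_of_le {n : ℕ} {a b : ℝ} (ha : 0 ≤ a) (hb : b ≤ 1)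
    (hab : 2 / 3 ^ (n + 1) ≤ b - a) : ∃ s ∈ wormholeHeights (n + 1), a ≤ s ∧ s ≤ b := by
  have h3 : (0 : ℝ) < 3 ^ (n + 1) := by positivity
  have hcov (k : ℕ) (hk : ¬ 3 ∣ k) (h1 : a * 3 ^ (n + 1) ≤ k) (h2 : (k : ℝ) ≤ b * 3 ^ (n + 1)) :
      ∃ s ∈ wormholeHeights (n + 1), a ≤ s ∧ s ≤ b := by
    have hkle : k ≤ 3 ^ (n + 1) := by
      have : (k : ℝ) ≤ 3 ^ (n + 1) := by nlinarith
      exact_mod_cast this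
    have hkne : k ≠ 3 ^ (n + 1) := by
      rintro rfl
      exact hk ⟨3 ^ n, by ring⟩
    exact ⟨k / 3 ^ (n + 1), (mem_wormholeHeights n _).2 ⟨k, by omega, hk, rfl⟩,
      by rwa [le_div_iff₀ h3], by rwa [div_le_iff₀ h3]⟩
  have h0 : 0 ≤ a * 3 ^ (n + 1) := by positivity
  have h1 := Nat.le_ceil (a * 3 ^ (n + 1))
  have h2 := Nat.ceil_lt_add_one h0
  have h4 : a * 3 ^ (n + 1) + 2 ≤ b * 3 ^ (n + 1) := by
    rw [div_le_iff₀ h3] at hab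
    linarith
  by_cases hk : 3 ∣ ⌈a * 3 ^ (n + 1)⌉₊
  · refine hcov (⌈a * 3 ^ (n + 1)⌉₊ + 1) (by omega) ?_ ?_ <;> push_cast <;> linarith
  · exact hcov _ hk h1 (by linarith)

/-! ### The quotient topology -/

@[simp] theorem height_proj (x : Strip) : height (proj x) = x.1 := rfl

theorem continuous_proj : Continuous proj := continuous_quot_mk

theorem isOpen_preimage_proj {U : Set Space} : IsOpen (proj ⁻¹' U) ↔ IsOpen U :=
  (isQuotientMap_quot_mk (X := Strip)).isOpen_preimage

theorem continuous_height : Continuous height := continuous_fst.quotient_lift _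

theorem proj_surjective : Function.Surjective proj := Quotient.mk_surjective

/-- At a wormhole level of order `n + 1`, points that differ at most in the digit with index `n`
are identified. -/
theorem proj_eq_of_mem_wormholeHeights {n : ℕ} {x y : Strip} (h : x.1 = y.1)
    (hx : (x.1 : ℝ) ∈ wormholeHeights (n + 1))
    (hd : ∀ m ≠ n, digits x.2 m = digits y.2 m) : proj x = proj y := by
  wlog hn : digits x.2 n = false generalizing x y
  · by_cases hn' : digits y.2 n = false
    · exact (this h.symm (h ▸ hx) (fun m hm => (hd m hm).symm) hn').symm
    · have : digits x.2 = digits y.2 := by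
        ext m
        by_cases hm : m = n
        · subst hm
          simp_all
        · rw [hd m hm]
      rw [Prod.ext h (digits.injective this)]
  cases hn' : digits y.2 n with
  | false =>
    have : digits x.2 = digits y.2 := by
      ext m
      by_cases hm : m = n
      · subst hm
        rw [hn, hn']
      · rw [hd m hm]
    rw [Prod.ext h (digits.injective this)]
  | true =>
    refine Quotient.sound (Relation.EqvGen.rel _ _ ((identified_iff x y).2
      ⟨h, n, hx, hn, ?_⟩))
    ext m
    by_cases hm : m = n
    · subst hm
      simp [hn']
    · simp [hm, hd m hm]

/-- Off the wormhole levels of order `n + 1`, the digit with index `n` descends to the quotient. -/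
theorem digit_eq_of_proj_eq {n : ℕ} {x y : Strip} (h : proj x = proj y)
    (hx : (x.1 : ℝ) ∉ wormholeHeights (n + 1)) : digits x.2 n = digits y.2 n := by
  have h' : Relation.EqvGen Identified x y := Quotient.exact h
  clear h
  induction h' with
  | rel x y hxy =>
    obtain ⟨-, m, hm, -, hy⟩ := (identified_iff x y).1 hxy
    have hne : n ≠ m := by
      rintro rfl
      exact hx hm
    rw [hy, Function.update_of_ne hne]
  | refl x => rfl
  | symm x y hxy ih => exact (ih (by rwa [eqvGen_fst_eq hxy])).symm
  | trans x y z hxy _ ih₁ ih₂ => exact (ih₁ hx).trans (ih₂ (by rwa [← eqvGen_fst_eq hxy]))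

/-- A connected set containing points that differ in the digit with index `n` meets a wormhole
level of order `n + 1`: on the rest of the space that digit is locally constant. -/
theorem exists_height_mem_wormholeHeights {S : Set Space} (hS : IsPreconnected S) {u v : Strip}
    (hu : proj u ∈ S) (hv : proj v ∈ S) {n : ℕ} (hne : digits u.2 n ≠ digits v.2 n) :
    ∃ z ∈ S, (height z : ℝ) ∈ wormholeHeights (n + 1) := by
  by_contra! hcon
  let U (b : Bool) : Set Space :=
    {z | (height z : ℝ) ∉ wormholeHeights (n + 1) ∧ ∃ w, proj w = z ∧ digits w.2 n = b}
  have hU (b : Bool) : IsOpen (U b) := by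
    rw [← isOpen_preimage_proj]
    have : proj ⁻¹' U b = {w : Strip | (w.1 : ℝ) ∉ wormholeHeights (n + 1)} ∩
        {w | digits w.2 n = b} := by
      ext w
      constructor
      · rintro ⟨h1, w', hw', hb⟩
        exact ⟨h1, (digit_eq_of_proj_eq hw'.symm h1).trans hb⟩
      · rintro ⟨h1, h2⟩
        exact ⟨h1, w, rfl, h2⟩
    rw [this]
    refine IsOpen.inter ?_ ?_
    · exact (wormholeHeights_finite (n + 1)).isClosed.isOpen_compl.preimage
        (f := fun w : Strip => (w.1 : ℝ)) (by fun_prop)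
    · exact (isOpen_discrete {b}).preimage (f := fun w : Strip => digits w.2 n)
        ((continuous_apply n).comp (digits.continuous.comp continuous_snd))
  have hmem (w : Strip) (hw : proj w ∈ S) : proj w ∈ U (digits w.2 n) :=
    ⟨hcon _ hw, w, rfl, rfl⟩
  have hcov : S ⊆ U (digits u.2 n) ∪ U (digits v.2 n) := by
    intro z hz
    obtain ⟨w, rfl⟩ := proj_surjective z
    have h := hmem w hz
    have h3 : digits w.2 n = digits u.2 n ∨ digits w.2 n = digits v.2 n := by
      revert hne
      cases digits w.2 n <;> cases digits u.2 n <;> cases digits v.2 n <;> simp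
    rcases h3 with h3 | h3
    · exact Or.inl (h3 ▸ h)
    · exact Or.inr (h3 ▸ h)
  obtain ⟨z, -, ⟨h1, w, hw, hwb⟩, -, w', hw', hwb'⟩ := hS _ _ (hU _) (hU _) hcov
    ⟨_, hu, hmem u hu⟩ ⟨_, hv, hmem v hv⟩
  refine hne (hwb ▸ hwb' ▸ digit_eq_of_proj_eq (hw.trans hw'.symm) ?_)
  rwa [← height_proj, hw]

/-- The strip coordinate that starts with the digits `ε` and switches to the digit `ε' n` at the
height `c n`. -/
def switch (ε ε' : ℕ → Bool) (c : ℕ → ℝ) (s : ℝ) : ℕ → Bool := fun n =>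
  if c n ≤ s then ε' n else ε n

theorem continuousAt_switch {ε ε' : ℕ → Bool} {c : ℕ → ℝ} {s : I} {n : ℕ}
    (h : ε n ≠ ε' n → c n ≠ s) : ContinuousAt (fun t : I => switch ε ε' c t n) s := by
  by_cases hn : ε n = ε' n
  · simp only [switch, hn, ite_self]
    exact continuousAt_const
  rcases (h hn).lt_or_gt with h | h
  · refine (continuousAt_const (y := ε' n)).congr ?_
    filter_upwards [continuous_subtype_val.continuousAt.eventually (lt_mem_nhds h)] with t ht
    simp [switch, ht.le]
  · refine (continuousAt_const (y := ε n)).congr ?_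
    filter_upwards [continuous_subtype_val.continuousAt.eventually (gt_mem_nhds h)] with t ht
    simp [switch, ht]

/-- The lift `s ↦ (s, switch ε ε' c s)` jumps at the heights `c n`, but these jumps are
identifications, so that its image in the quotient is continuous. -/
theorem continuous_proj_switch {ε ε' : ℕ → Bool} {c : ℕ → ℝ}
    (hc : ∀ n, ε n ≠ ε' n → c n ∈ wormholeHeights (n + 1)) :
    Continuous fun s : I => proj (s, digits.symm (switch ε ε' c s)) := by
  refine continuous_iff_continuousAt.2 fun s => ?_
  by_cases h : ∃ n, ε n ≠ ε' n ∧ c n = s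
  · obtain ⟨n, hn, hs⟩ := h
    have hcont (b : Bool) : ContinuousAt
        (fun t : I => proj (t, digits.symm (Function.update (switch ε ε' c t) n b))) s := by
      refine continuous_proj.continuousAt.comp (continuousAt_id.prodMk
        (digits.symm.continuous.continuousAt.comp (continuousAt_pi.2 fun m => ?_)))
      by_cases hm : m = n
      · subst hm
        simp only [Function.update_self]
        exact continuousAt_const
      · simp only [Function.update_of_ne hm]
        refine continuousAt_switch fun hm' hms => hm ?_
        exact wormholeHeights_disjoint (hc m hm') (by rw [hms, ← hs]; exact hc n hn)
    have heq (b : Bool) : proj (s, digits.symm (Function.update (switch ε ε' c s) n b)) =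
        proj (s, digits.symm (switch ε ε' c s)) := by
      refine proj_eq_of_mem_wormholeHeights (n := n) rfl (by rw [← hs]; exact hc n hn)
        fun m hm => ?_
      simp [hm]
    intro V hV
    have hV' (b : Bool) :
        V ∈ 𝓝 (proj (s, digits.symm (Function.update (switch ε ε' c s) n b))) := by
      rw [heq]
      exact hV
    have h1 := hcont true (hV' true)
    have h2 := hcont false (hV' false)
    rw [Filter.mem_map] at h1 h2 ⊢
    -- at each height the lift is one of the two lifts with the digit `n` frozen
    filter_upwards [h1, h2] with t ht1 ht2
    rw [Set.mem_preimage, ← Function.update_eq_self n (switch ε ε' c t)]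
    cases switch ε ε' c t n
    · exact ht2
    · exact ht1
  · push Not at h
    exact continuous_proj.continuousAt.comp (continuousAt_id.prodMk
      (digits.symm.continuous.continuousAt.comp (continuousAt_pi.2 fun m =>
        continuousAt_switch (h m))))

/-! ### Lengths of sets in the strip -/

theorem continuous_toPlane : Continuous toPlane := by
  refine (PiLp.continuous_toLp 2 _).comp (continuous_pi fun i => ?_)
  fin_cases i
  · exact continuous_subtype_val.comp continuous_fst
  · exact continuous_subtype_val.comp continuous_snd

theorem toPlane_injective : Function.Injective toPlane := fun x y h => by
  have h0 := congrFun (congrArg WithLp.ofLp h) 0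
  have h1 := congrFun (congrArg WithLp.ofLp h) 1
  exact Prod.ext (Subtype.ext (by simpa [toPlane] using h0))
    (Subtype.ext (by simpa [toPlane] using h1))

theorem lipschitz_coord_zero : LipschitzWith 1 fun v : EuclideanSpace ℝ (Fin 2) => v 0 :=
  LipschitzWith.of_dist_le_mul fun v w => by
    rw [NNReal.coe_one, one_mul, dist_eq_norm, dist_eq_norm]
    exact PiLp.norm_apply_le (v - w) 0

/-- The heights of a subset of the strip have at most the length of the subset. -/
theorem volume_heights_le (P : Set Strip) :
    volume ((fun x : Strip => (x.1 : ℝ)) '' P) ≤ μH[1] (toPlane '' P) := by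
  have h := (lipschitz_coord_zero.lipschitzOnWith (s := toPlane '' P)).hausdorffMeasure_image_le
    (d := 1) zero_le_one
  rw [Set.image_image, hausdorffMeasure_real] at h
  simpa [toPlane] using h

/-- A subset of the strip is at least as long as the set of its heights plus the set of heights
at which it has two points. -/
theorem volume_add_volume_le_hausdorffMeasure (P : Set Strip) {E₁ E₂ : Set ℝ}
    (h₁ : ∀ t ∈ E₁, ∃ x ∈ P, (x.1 : ℝ) = t)
    (h₂ : ∀ t ∈ E₂, ∃ x ∈ P, ∃ y ∈ P, (x.1 : ℝ) = t ∧ (y.1 : ℝ) = t ∧ x.2 ≠ y.2) :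
    volume E₁ + volume E₂ ≤ μH[1] (toPlane '' P) := by
  let W (m : ℕ) (x : Strip) : Fin m → Bool := fun i => digits x.2 i
  have hW (m : ℕ) : Continuous (W m) := continuous_pi fun i =>
    (continuous_apply (i : ℕ)).comp (digits.continuous.comp continuous_snd)
  let A (m : ℕ) (w : Fin m → Bool) : Set ℝ :=
    (fun x : Strip => (x.1 : ℝ)) '' (P ∩ W m ⁻¹' {w})
  let D (m : ℕ) : Set ℝ := {t | ∃ w w', w ≠ w' ∧ t ∈ A m w ∧ t ∈ A m w'}
  have hsum (m : ℕ) : ∑ w, volume (A m w) ≤ μH[1] (toPlane '' P) := by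
    have hmeas (w : Fin m → Bool) : MeasurableSet (toPlane '' (W m ⁻¹' {w})) := by
      refine IsCompact.measurableSet (IsCompact.image ?_ continuous_toPlane)
      have : CompactSpace cantorSet := isCompact_iff_compactSpace.1 isCompact_cantorSet
      exact ((isClosed_discrete {w}).preimage (hW m)).isCompact
    calc ∑ w, volume (A m w) ≤ ∑ w, μH[1] (toPlane '' (P ∩ W m ⁻¹' {w})) :=
          Finset.sum_le_sum fun w _ => volume_heights_le _
      _ = ∑ w, (μH[1]).restrict (toPlane '' P) (toPlane '' (W m ⁻¹' {w})) := by
          refine Finset.sum_congr rfl fun w _ => ?_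
          rw [Measure.restrict_apply (hmeas w), ← Set.image_inter toPlane_injective,
            Set.inter_comm]
      _ = (μH[1]).restrict (toPlane '' P) (⋃ w, toPlane '' (W m ⁻¹' {w})) := by
          rw [measure_iUnion (fun w w' hww' => ?_) hmeas, tsum_fintype]
          refine (Set.disjoint_image_iff toPlane_injective).2 ?_
          exact (Set.disjoint_singleton.2 hww').preimage _
      _ ≤ μH[1] (toPlane '' P) := (measure_mono (Set.subset_univ _)).trans (by simp)
  have hm (m : ℕ) : volume E₁ + volume (E₂ ∩ D m) ≤ μH[1] (toPlane '' P) := by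
    refine le_trans (add_le_add (measure_mono ?_) (measure_mono Set.inter_subset_right))
      ((measure_iUnion_add_le_sum volume (A m)).trans (hsum m))
    intro t ht
    obtain ⟨x, hx, rfl⟩ := h₁ t ht
    exact Set.mem_iUnion.2 ⟨W m x, x, ⟨hx, rfl⟩, rfl⟩
  have hmono : Monotone fun m => E₂ ∩ D m := by
    refine monotone_nat_of_le_succ fun m t ht => ⟨ht.1, ?_⟩
    obtain ⟨w, w', hww', ⟨x, ⟨hx, rfl⟩, hxt⟩, ⟨y, ⟨hy, rfl⟩, hyt⟩⟩ := ht.2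
    refine ⟨W (m + 1) x, W (m + 1) y, fun h => hww' ?_, ⟨x, ⟨hx, rfl⟩, hxt⟩, ⟨y, ⟨hy, rfl⟩, hyt⟩⟩
    ext i
    exact congrFun h i.castSucc
  have hU : E₂ ⊆ ⋃ m, E₂ ∩ D m := by
    intro t ht
    obtain ⟨x, hx, y, hy, hxt, hyt, hne⟩ := h₂ t ht
    obtain ⟨n, hn⟩ := Function.ne_iff.1 (digits.injective.ne hne)
    exact Set.mem_iUnion.2 ⟨n + 1, ht, W (n + 1) x, W (n + 1) y,
      fun h => hn (congrFun h (Fin.last n)), ⟨x, ⟨hx, rfl⟩, hxt⟩, ⟨y, ⟨hy, rfl⟩, hyt⟩⟩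
  refine (add_le_add_right (measure_mono hU) _).trans ?_
  refine le_of_tendsto ((tendsto_measure_iUnion_atTop hmono).const_add _)
    (Filter.Eventually.of_forall hm)

/-! ### The distance formula -/

theorem edist_comm (x y : Space) : edist x y = edist y x := by
  have h (x y : Space) : edist x y ≤ edist y x := by
    refine le_iInf₂ fun P ⟨γ, hγ⟩ => iInf₂_le P ⟨γ.symm, ?_⟩
    rw [Path.symm_range, hγ]
  exact le_antisymm (h x y) (h y x)

theorem edist_triangle (x y z : Space) : edist x z ≤ edist x y + edist y z := by
  unfold edist
  simp only [ENNReal.iInf_add, ENNReal.add_iInf]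
  refine le_iInf₂ fun Q ⟨γ', hγ'⟩ => le_iInf₂ fun P ⟨γ, hγ⟩ => ?_
  have hPQ : Set.range (γ.trans γ') = proj '' (P ∪ Q) := by
    rw [Path.trans_range, hγ, hγ', Set.image_union]
  refine (iInf₂_le (P ∪ Q) ⟨γ.trans γ', hPQ⟩).trans ?_
  rw [Set.image_union]
  exact measure_union_le _ _

theorem abs_ofBits_switch_sub_le {ε ε' : ℕ → Bool} {c : ℕ → ℝ} {s t : ℝ} (hst : s ≤ t) :
    |ofBits (switch ε ε' c s) - ofBits (switch ε ε' c t)| ≤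
      ∑' n, if s < c n ∧ c n ≤ t then (if ε n ≠ ε' n then (2 : ℝ) / 3 ^ (n + 1) else 0) else 0 := by
  refine (abs_ofBits_sub_le _ _).trans (le_of_eq (tsum_congr fun n => ?_))
  unfold switch
  by_cases h1 : c n ≤ s
  · simp [h1, h1.trans hst, not_lt.2 h1]
  · by_cases h2 : c n ≤ t
    · simp [h1, h2, not_le.1 h1]
    · simp [h1, h2]

/-- A path that climbs from `u` to `v` and switches every digit at a wormhole level on its way has
as its length the difference of the heights. -/
theorem edist_le_of_ascent {u v : Strip} (huv : u.1 ≤ v.1)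
    (h : ∀ n, digits u.2 n ≠ digits v.2 n →
      ∃ s ∈ wormholeHeights (n + 1), (u.1 : ℝ) ≤ s ∧ s ≤ v.1) :
    edist (proj u) (proj v) ≤ ENNReal.ofReal (v.1 - u.1) := by
  classical
  obtain ⟨a, k⟩ := u
  obtain ⟨b, k'⟩ := v
  simp only at huv h ⊢
  have huv' : (a : ℝ) ≤ b := huv
  choose! c hc hac hcb using h
  let Λ (s : I) : Strip := (s, digits.symm (switch (digits k) (digits k') c s))
  let Φ (s : ℝ) : EuclideanSpace ℝ (Fin 2) := !₂[s, ofBits (switch (digits k) (digits k') c s)]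
  have hinj {m n : ℕ} (hm : digits k m ≠ digits k' m) (hn : digits k n ≠ digits k' n)
      (hmn : c m = c n) : m = n :=
    wormholeHeights_disjoint (hc m hm) (hmn ▸ hc n hn)
  -- if a digit switches at the height `a` itself, the lift starts at the other representative
  have hΛa : proj (Λ a) = proj (a, k) := by
    by_cases hex : ∃ n, digits k n ≠ digits k' n ∧ c n = a
    · obtain ⟨n, hn, hna⟩ := hex
      refine proj_eq_of_mem_wormholeHeights (n := n) rfl (by rw [← hna]; exact hc n hn)
        fun m hm => ?_
      simp only [Λ, Homeomorph.apply_symm_apply, switch]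
      by_cases hd : digits k m = digits k' m
      · simp [hd]
      · rw [if_neg]
        intro hle
        exact hm (hinj hd hn ((le_antisymm hle (hac m hd)).trans hna.symm))
    · push Not at hex
      refine congrArg proj (Prod.ext rfl ?_)
      simp only [Λ]
      rw [Homeomorph.symm_apply_eq]
      ext n
      unfold switch
      by_cases hd : digits k n = digits k' n
      · simp [hd]
      · rw [if_neg]
        intro hle
        exact hex n hd (le_antisymm hle (hac n hd))
  have hΛb : Λ b = (b, k') := by
    refine Prod.ext rfl ?_
    simp only [Λ]
    rw [Homeomorph.symm_apply_eq]
    ext n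
    unfold switch
    by_cases hd : digits k n = digits k' n
    · simp [hd]
    · rw [if_pos (hcb n hd)]
  let ℓ (t : I) : I := ⟨a + t * (b - a), by
      have := mul_nonneg t.2.1 (sub_nonneg.2 huv')
      linarith [a.2.1], by
      have := mul_le_mul_of_nonneg_right t.2.2 (sub_nonneg.2 huv')
      linarith [b.2.2]⟩
  have hℓ : Continuous ℓ := by fun_prop
  have hℓr : Set.range ℓ = Set.Icc a b := by
    ext s
    constructor
    · rintro ⟨t, rfl⟩
      have h1 := mul_nonneg t.2.1 (sub_nonneg.2 huv')
      have h2 := mul_le_mul_of_nonneg_right t.2.2 (sub_nonneg.2 huv')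
      exact ⟨Subtype.coe_le_coe.1 (by simp only [ℓ]; linarith),
        Subtype.coe_le_coe.1 (by simp only [ℓ]; linarith)⟩
    · rintro ⟨h1, h2⟩
      have h1' : (a : ℝ) ≤ s := h1
      have h2' : (s : ℝ) ≤ b := h2
      rcases huv'.eq_or_lt with hab | hab
      · refine ⟨0, Subtype.ext ?_⟩
        simp only [ℓ]
        simp only [Set.Icc.coe_zero]
        linarith
      · have hpos := sub_pos.2 hab
        refine ⟨⟨(s - a) / (b - a), div_nonneg (by linarith) hpos.le,
          (div_le_one hpos).2 (by linarith)⟩, Subtype.ext ?_⟩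
        simp only [ℓ]
        field_simp
        ring
  have hℓ0 : ℓ 0 = a := Subtype.ext (by simp [ℓ])
  have hℓ1 : ℓ 1 = b := Subtype.ext (by simp [ℓ])
  let γ : Path (proj (a, k)) (proj (b, k')) :=
    { toFun := fun t => proj (Λ (ℓ t))
      continuous_toFun := (continuous_proj_switch hc).comp hℓ
      source' := by rw [hℓ0, hΛa]
      target' := by rw [hℓ1, hΛb] }
  have hγ : Set.range γ = proj '' (Λ '' Set.Icc a b) := by
    rw [← hℓr, ← Set.range_comp, ← Set.range_comp]
    rfl
  have himage : toPlane '' (Λ '' Set.Icc a b) = Φ '' Set.Icc (a : ℝ) b := by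
    have hpt (s : I) : toPlane (Λ s) = Φ s := by
      simp only [toPlane, Λ, Φ, coe_digits_symm]
    ext z
    constructor
    · rintro ⟨_, ⟨s, hs, rfl⟩, rfl⟩
      exact ⟨s, ⟨hs.1, hs.2⟩, (hpt s).symm⟩
    · rintro ⟨s, hs, rfl⟩
      exact ⟨_, ⟨⟨s, a.2.1.trans hs.1, hs.2.trans b.2.2⟩, ⟨hs.1, hs.2⟩, rfl⟩, hpt _⟩
  refine (iInf₂_le (Λ '' Set.Icc a b) ⟨γ, hγ⟩).trans ?_
  rw [himage]
  have hw {n : ℕ} (hn : (if digits k n ≠ digits k' n then (2 : ℝ) / 3 ^ (n + 1) else 0) ≠ 0) :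
      digits k n ≠ digits k' n := fun h => hn (by simp [h])
  refine hausdorffMeasure_image_Icc_le_of_jumps (c := c)
    (w := fun n => if digits k n ≠ digits k' n then (2 : ℝ) / 3 ^ (n + 1) else 0)
    (fun n => by split_ifs <;> positivity) (summable_ite_weights _) huv'
    (fun n hn => ⟨hac n (hw hn), hcb n (hw hn)⟩) (fun m n hm hn => hinj (hw hm) (hw hn))
    fun s t _ hst _ => ?_
  have hΦ : Dist.dist (Φ s) (Φ t) ≤ |s - t| + |ofBits (switch (digits k) (digits k') c s) -
      ofBits (switch (digits k) (digits k') c t)| := by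
    rw [EuclideanSpace.dist_eq, Fin.sum_univ_two]
    refine Real.sqrt_le_iff.2 ⟨by positivity, ?_⟩
    simp only [Φ, Real.dist_eq]
    have := mul_nonneg (abs_nonneg (s - t))
      (abs_nonneg (ofBits (switch (digits k) (digits k') c s) -
        ofBits (switch (digits k) (digits k') c t)))
    simp
    nlinarith [sq_abs (s - t), sq_abs (ofBits (switch (digits k) (digits k') c s) -
      ofBits (switch (digits k) (digits k') c t))]
  refine hΦ.trans (add_le_add ?_ (abs_ofBits_switch_sub_le hst))
  rw [abs_sub_comm, abs_of_nonneg (sub_nonneg.2 hst)]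

/-- The interval `[a, b]` contains the heights of `u` and `v` and, for each digit in which they
differ, a wormhole level at which this digit can be changed. -/
structure Spans (a b : ℝ) (u v : Strip) : Prop where
  le_left : a ≤ u.1
  le_right : a ≤ v.1
  left_le : (u.1 : ℝ) ≤ b
  right_le : (v.1 : ℝ) ≤ b
  meets : ∀ n, digits u.2 n ≠ digits v.2 n → ∃ s ∈ wormholeHeights (n + 1), a ≤ s ∧ s ≤ b

theorem Spans.symm {a b : ℝ} {u v : Strip} (h : Spans a b u v) : Spans a b v u :=
  ⟨h.le_right, h.le_left, h.right_le, h.left_le, fun n hn => h.meets n hn.symm⟩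

theorem spans_zero_one (u v : Strip) : Spans 0 1 u v :=
  ⟨u.1.2.1, v.1.2.1, u.1.2.2, v.1.2.2, fun n _ => exists_wormhole_of_le le_rfl le_rfl (by
    rw [div_le_iff₀ (by positivity), sub_zero, one_mul, pow_succ]
    nlinarith [one_le_pow₀ (show (1 : ℝ) ≤ 3 by norm_num) (n := n)])⟩

/-- The length of a shortest path of height range `[a, b]` between points at heights `s` and `t`,
each part of `[a, b]` outside the heights between `s` and `t` being traversed twice. -/
def cost (a b s t : ℝ) : ℝ := 2 * (b - a) - |s - t|

theorem Spans.sub_le_cost {a b : ℝ} {u v : Strip} (h : Spans a b u v) :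
    b - a ≤ cost a b u.1 v.1 := by
  have := h.le_left
  have := h.le_right
  have := h.left_le
  have := h.right_le
  have : |(u.1 : ℝ) - v.1| ≤ b - a := abs_le.2 ⟨by linarith, by linarith⟩
  unfold cost
  linarith

theorem Spans.edist_le {a b : ℝ} {u v : Strip} (h : Spans a b u v) :
    edist (proj u) (proj v) ≤ ENNReal.ofReal (cost a b u.1 v.1) := by
  wlog huv : u.1 ≤ v.1 generalizing u v
  · rw [edist_comm, cost, abs_sub_comm]
    exact this h.symm (le_of_not_ge huv)
  have huv' : (u.1 : ℝ) ≤ v.1 := huv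
  have h1 := h.le_left
  have h2 := h.right_le
  have hu := u.1.2
  have hv := v.1.2
  let a' : I := ⟨max a 0, le_max_right _ _, max_le (h1.trans hu.2) zero_le_one⟩
  let b' : I := ⟨min b 1, le_min (hv.1.trans h2) zero_le_one, min_le_right _ _⟩
  have ha' : (a' : ℝ) ≤ u.1 := max_le h1 hu.1
  have hb' : (v.1 : ℝ) ≤ b' := le_min h2 hv.2
  have e1 : edist (proj u) (proj (a', u.2)) ≤ ENNReal.ofReal (u.1 - a') := by
    rw [edist_comm]
    exact edist_le_of_ascent (u := (a', u.2)) (v := u) ha' (fun n hn => absurd rfl hn)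
  have e2 : edist (proj (a', u.2)) (proj (b', v.2)) ≤ ENNReal.ofReal (b' - a') :=
    edist_le_of_ascent (u := (a', u.2)) (v := (b', v.2))
      (Subtype.coe_le_coe.1 (ha'.trans (huv'.trans hb'))) fun n hn => by
        obtain ⟨s, hs, has, hsb⟩ := h.meets n hn
        have hs01 := wormholeHeights_subset_Icc n hs
        exact ⟨s, hs, max_le has hs01.1, le_min hsb hs01.2⟩
  have e3 : edist (proj (b', v.2)) (proj v) ≤ ENNReal.ofReal (b' - v.1) := by
    rw [edist_comm]
    exact edist_le_of_ascent (u := v) (v := (b', v.2)) hb' (fun n hn => absurd rfl hn)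
  calc edist (proj u) (proj v)
      ≤ edist (proj u) (proj (a', u.2)) + (edist (proj (a', u.2)) (proj (b', v.2)) +
          edist (proj (b', v.2)) (proj v)) :=
        (edist_triangle _ _ _).trans (by gcongr; exact edist_triangle _ _ _)
    _ ≤ ENNReal.ofReal (u.1 - a') + (ENNReal.ofReal (b' - a') + ENNReal.ofReal (b' - v.1)) := by
        gcongr
    _ = ENNReal.ofReal ((u.1 - a') + ((b' - a') + (b' - v.1))) := by
        rw [ENNReal.ofReal_add, ENNReal.ofReal_add] <;> linarith
    _ ≤ ENNReal.ofReal (cost a b u.1 v.1) := by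
        refine ENNReal.ofReal_le_ofReal ?_
        have : a ≤ a' := le_max_left _ _
        have : b' ≤ b := min_le_left _ _
        rw [cost, abs_sub_comm, abs_of_nonneg (sub_nonneg.2 huv')]
        linarith

/-- Up to an arbitrarily small error, a path from `u` to `v` is at least as long as the cost of some
interval that spans `u` and `v`. The interval is bounded by the levels closest to the heights of `u`
and `v` that the path meets in at most one point: cutting the path there does not disconnect it, and
all levels in between, except those between `u` and `v`, are met twice. -/
theorem exists_spans_of_path {u v : Strip} (γ : Path (proj u) (proj v)) {P : Set Strip}
    (hP : Set.range γ = proj '' P) {ε : ℝ} (hε : 0 < ε) : ∃ a b, Spans a b u v ∧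
      ENNReal.ofReal (cost a b u.1 v.1 - ε) ≤ μH[1] (toPlane '' P) := by
  set C : Set Space := Set.range γ with hC
  let h (z : Space) : ℝ := height z
  have hh : Continuous h := continuous_subtype_val.comp continuous_height
  have hCp : IsPreconnected C := isPreconnected_range γ.continuous
  have huC : proj u ∈ C := ⟨0, γ.source⟩
  have hvC : proj v ∈ C := ⟨1, γ.target⟩
  set m : ℝ := min u.1 v.1 with hm
  set M : ℝ := max u.1 v.1 with hM
  have hm0 : 0 ≤ m := le_min u.1.2.1 v.1.2.1
  have hM1 : M ≤ 1 := max_le u.1.2.2 v.1.2.2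
  have hmM : m ≤ M := min_le_max
  let A : Set ℝ := {t | t ≤ m ∧ (C ∩ {z | h z = t}).Subsingleton}
  let B : Set ℝ := {t | M ≤ t ∧ (C ∩ {z | h z = t}).Subsingleton}
  -- the fibres outside the unit interval are empty
  have hA : A.Nonempty := ⟨-1, by linarith, fun z hz => absurd hz.2
    (by have := (height z).2.1; exact fun h' : (height z : ℝ) = _ => by linarith)⟩
  have hB : B.Nonempty := ⟨2, by linarith, fun z hz => absurd hz.2
    (by have := (height z).2.2; exact fun h' : (height z : ℝ) = _ => by linarith)⟩
  have hAb : BddAbove A := ⟨m, fun t ht => ht.1⟩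
  have hBb : BddBelow B := ⟨M, fun t ht => ht.1⟩
  obtain ⟨a, haA, ha⟩ := exists_lt_of_lt_csSup hA (show sSup A - ε / 4 < sSup A by linarith)
  obtain ⟨b, hbB, hb⟩ := exists_lt_of_csInf_lt hB (show sInf B < sInf B + ε / 4 by linarith)
  have hAm : sSup A ≤ m := csSup_le hA fun t ht => ht.1
  have hBM : M ≤ sInf B := le_csInf hB fun t ht => ht.1
  have hau : a ≤ u.1 := haA.1.trans (min_le_left _ _)
  have hav : a ≤ v.1 := haA.1.trans (min_le_right _ _)
  have hub : (u.1 : ℝ) ≤ b := (le_max_left _ _).trans hbB.1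
  have hvb : (v.1 : ℝ) ≤ b := (le_max_right _ _).trans hbB.1
  -- the supremum and the infimum need not be attained; this is what `ε` pays for
  refine ⟨a, b, ⟨hau, hav, hub, hvb, fun n hn => ?_⟩, ?_⟩
  · have hS := (hCp.inter_le_of_subsingleton hh haA.2).inter_ge_of_subsingleton hh
      (hbB.2.anti (Set.inter_subset_inter_left _ Set.inter_subset_left))
    obtain ⟨z, ⟨⟨-, h1⟩, h2⟩, hz⟩ := exists_height_mem_wormholeHeights hS
      (u := u) (v := v) ⟨⟨huC, hau⟩, hub⟩ ⟨⟨hvC, hav⟩, hvb⟩ hn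
    exact ⟨h z, hz, h1, h2⟩
  -- two points of `P` at each level whose fibre in the path is not a single point
  have htwo (t : ℝ) (ht : ¬ (C ∩ {z | h z = t}).Subsingleton) :
      ∃ x ∈ P, ∃ y ∈ P, (x.1 : ℝ) = t ∧ (y.1 : ℝ) = t ∧ x.2 ≠ y.2 := by
    rw [Set.not_subsingleton_iff] at ht
    obtain ⟨z, ⟨hz, hzt⟩, z', ⟨hz', hzt'⟩, hne⟩ := ht
    rw [hP] at hz hz'
    obtain ⟨x, hx, rfl⟩ := hz
    obtain ⟨y, hy, rfl⟩ := hz'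
    refine ⟨x, hx, y, hy, hzt, hzt', fun h2 => hne ?_⟩
    rw [Prod.ext (Subtype.ext (hzt.trans hzt'.symm)) h2]
  have hlow (t : ℝ) (h1 : sSup A < t) (h2 : t < m) : ¬ (C ∩ {z | h z = t}).Subsingleton :=
    fun hs => (le_csSup hAb ⟨h2.le, hs⟩).not_gt h1
  have hhigh (t : ℝ) (h1 : M < t) (h2 : t < sInf B) : ¬ (C ∩ {z | h z = t}).Subsingleton :=
    fun hs => (csInf_le hBb ⟨h1.le, hs⟩).not_gt h2
  have hmid (t : ℝ) (h1 : m ≤ t) (h2 : t ≤ M) : ∃ x ∈ P, (x.1 : ℝ) = t := by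
    have hord : (h '' C).OrdConnected := (hCp.image h hh.continuousOn).ordConnected
    have hmem : m ∈ h '' C ∧ M ∈ h '' C := by
      rcases le_total (u.1 : ℝ) v.1 with h' | h'
      · rw [hm, hM, min_eq_left h', max_eq_right h']
        exact ⟨⟨_, huC, rfl⟩, ⟨_, hvC, rfl⟩⟩
      · rw [hm, hM, min_eq_right h', max_eq_left h']
        exact ⟨⟨_, hvC, rfl⟩, ⟨_, huC, rfl⟩⟩
    obtain ⟨z, hz, hzt⟩ := hord.out hmem.1 hmem.2 ⟨h1, h2⟩
    rw [hP] at hz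
    obtain ⟨x, hx, rfl⟩ := hz
    exact ⟨x, hx, hzt⟩
  have key := volume_add_volume_le_hausdorffMeasure P (E₁ := Set.Ioo (sSup A) (sInf B))
    (E₂ := Set.Ioo (sSup A) m ∪ Set.Ioo M (sInf B)) (fun t ht => by
      rcases lt_or_ge t m with h1 | h1
      · obtain ⟨x, hx, -, -, hxt, -⟩ := htwo t (hlow t ht.1 h1)
        exact ⟨x, hx, hxt⟩
      · rcases lt_or_ge M t with h2 | h2
        · obtain ⟨x, hx, -, -, hxt, -⟩ := htwo t (hhigh t h2 ht.2)
          exact ⟨x, hx, hxt⟩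
        · exact hmid t h1 h2) (fun t ht => by
      rcases ht with ht | ht
      · exact htwo t (hlow t ht.1 ht.2)
      · exact htwo t (hhigh t ht.1 ht.2))
  refine le_trans ?_ key
  rw [measure_union (Set.disjoint_left.2 fun t h1 h2 => by linarith [h1.2, h2.1]) measurableSet_Ioo,
    Real.volume_Ioo, Real.volume_Ioo, Real.volume_Ioo, ← ENNReal.ofReal_add (by linarith)
    (by linarith), ← ENNReal.ofReal_add (by linarith) (by linarith)]
  refine ENNReal.ofReal_le_ofReal ?_
  have : |(u.1 : ℝ) - v.1| = M - m := (max_sub_min_eq_abs' _ _).symm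
  rw [cost, this]
  linarith

theorem edist_ne_top (x y : Space) : edist x y ≠ ⊤ := by
  obtain ⟨u, rfl⟩ := proj_surjective x
  obtain ⟨v, rfl⟩ := proj_surjective y
  exact ne_top_of_le_ne_top ENNReal.ofReal_ne_top (spans_zero_one u v).edist_le

theorem dist_nonneg (x y : Space) : 0 ≤ dist x y := ENNReal.toReal_nonneg

theorem Spans.dist_le {a b : ℝ} {u v : Strip} (h : Spans a b u v) :
    dist (proj u) (proj v) ≤ cost a b u.1 v.1 := by
  refine ENNReal.toReal_le_of_le_ofReal (le_trans ?_ h.sub_le_cost) h.edist_le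
  linarith [h.le_left, h.left_le]

theorem exists_spans_cost_lt (u v : Strip) {ε : ℝ} (hε : 0 < ε) :
    ∃ a b, Spans a b u v ∧ cost a b u.1 v.1 < dist (proj u) (proj v) + ε := by
  have hlt : edist (proj u) (proj v) < edist (proj u) (proj v) + ENNReal.ofReal (ε / 2) :=
    ENNReal.lt_add_right (edist_ne_top _ _) (by simpa using hε)
  conv_lhs at hlt => unfold edist
  simp only [iInf_lt_iff] at hlt
  obtain ⟨P, ⟨γ, hP⟩, hlt⟩ := hlt
  obtain ⟨a, b, hab, hle⟩ := exists_spans_of_path γ hP (half_pos hε)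
  refine ⟨a, b, hab, ?_⟩
  have h := hle.trans_lt hlt
  rw [← ENNReal.ofReal_toReal (edist_ne_top (proj u) (proj v)),
    ← ENNReal.ofReal_add ENNReal.toReal_nonneg (half_pos hε).le] at h
  have hd : dist (proj u) (proj v) = (edist (proj u) (proj v)).toReal := rfl
  have h' := (ENNReal.ofReal_lt_ofReal_iff (by linarith [dist_nonneg (proj u) (proj v)])).1 h
  linarith

theorem abs_height_sub_le_dist (x y : Space) : |(height x : ℝ) - height y| ≤ dist x y := by
  obtain ⟨u, rfl⟩ := proj_surjective x
  obtain ⟨v, rfl⟩ := proj_surjective y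
  refine le_of_forall_pos_lt_add fun ε hε => ?_
  obtain ⟨a, b, h, hlt⟩ := exists_spans_cost_lt u v hε
  refine lt_of_le_of_lt (le_trans ?_ h.sub_le_cost) hlt
  exact abs_le.2 ⟨by simp only [height_proj]; linarith [h.le_left, h.right_le],
    by simp only [height_proj]; linarith [h.le_right, h.left_le]⟩

/-- Points of the strip with the same strip coordinate are as far apart as their heights. -/
theorem dist_proj_same (s t : I) (k : cantorSet) :
    dist (proj (s, k)) (proj (t, k)) = |(s : ℝ) - t| := by
  refine le_antisymm ?_ (abs_height_sub_le_dist (proj (s, k)) (proj (t, k)))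
  have h : Spans (min (s : ℝ) t) (max (s : ℝ) t) (s, k) (t, k) :=
    ⟨min_le_left _ _, min_le_right _ _, le_max_left _ _, le_max_right _ _,
      fun n hn => absurd rfl hn⟩
  refine h.dist_le.trans (le_of_eq ?_)
  rw [cost, max_sub_min_eq_abs']
  ring

/-! ### Differentiability of the distance off countably many heights -/

/-- Near a point at which no two of finitely many affine functions of different slopes agree, one
of them is the smallest. -/
theorem exists_eventually_forall_affine_le {ι : Type*} (S : Finset ι) (hS : S.Nonempty)
    (c s : ι → ℝ) (t₀ : ℝ)
    (htie : ∀ i ∈ S, ∀ j ∈ S, c i + s i * t₀ = c j + s j * t₀ → s i = s j) :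
    ∃ i ∈ S, ∀ᶠ t in 𝓝 t₀, ∀ j ∈ S, c i + s i * t ≤ c j + s j * t := by
  obtain ⟨i, hi, hmin⟩ := S.exists_min_image (fun i => c i + s i * t₀) hS
  refine ⟨i, hi, (Filter.eventually_all_finset S).2 fun j hj => ?_⟩
  rcases (hmin j hj).lt_or_eq with h | h
  · have hi' : ContinuousAt (fun t => c i + s i * t) t₀ := by fun_prop
    have hj' : ContinuousAt (fun t => c j + s j * t) t₀ := by fun_prop
    exact (hi'.eventually_lt hj' h).mono fun t ht => ht.le
  · have hs := htie i hi j hj h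
    refine Filter.Eventually.of_forall fun t => le_of_eq ?_
    rw [hs] at h ⊢
    linarith

/-- The rational combinations of `1` and the height `q`. They contain all wormhole levels and `q`,
and also every height at which the distance from a point at height `q` fails to be
differentiable. -/
def exceptionalHeights (q : ℝ) : Submodule ℚ ℝ := Submodule.span ℚ {1, q}

theorem countable_exceptionalHeights (q : ℝ) : (exceptionalHeights q : Set ℝ).Countable := by
  refine (Set.countable_range fun r : ℚ × ℚ => r.1 • (1 : ℝ) + r.2 • q).mono fun t ht => ?_
  obtain ⟨a, b, h⟩ := Submodule.mem_span_pair.1 ht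
  exact ⟨(a, b), h⟩

theorem self_mem_exceptionalHeights (q : ℝ) : q ∈ exceptionalHeights q :=
  Submodule.subset_span (by simp)

theorem wormholeHeights_subset_exceptionalHeights (q : ℝ) (n : ℕ) :
    wormholeHeights (n + 1) ⊆ exceptionalHeights q := by
  intro t ht
  obtain ⟨k, -, -, rfl⟩ := (mem_wormholeHeights n t).1 ht
  have h1 : (1 : ℝ) ∈ exceptionalHeights q := Submodule.subset_span (by simp)
  have h := (exceptionalHeights q).smul_mem ((k : ℚ) / 3 ^ (n + 1)) h1
  rw [Rat.smul_def] at h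
  simpa using h

/-- An endpoint of a candidate interval for points at a varying height `t`: either a fixed real
number or, for `none`, the height `t` itself. -/
def endpoint (o : Option ℝ) (t : ℝ) : ℝ := o.getD t

/-- The part of `Spans a b u w` that concerns the digits with index less than `N`, with the
height of the first point replaced by `t`. -/
structure SpansBelow (N : ℕ) (u w : Strip) (t a b : ℝ) : Prop where
  le_left : a ≤ t
  le_right : a ≤ w.1
  left_le : t ≤ b
  right_le : (w.1 : ℝ) ≤ b
  meets : ∀ n < N, digits u.2 n ≠ digits w.2 n →
    ∃ s ∈ wormholeHeights (n + 1), a ≤ s ∧ s ≤ b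

/-- An interval can be shrunk until its endpoints are in any prescribed finite set that contains
the heights it has to contain. -/
theorem SpansBelow.exists_endpoints {N : ℕ} {u w : Strip} {t a b : ℝ}
    (h : SpansBelow N u w t a b) {E : Finset ℝ} (hw : (w.1 : ℝ) ∈ E)
    (hE : ∀ n < N, wormholeHeights (n + 1) ⊆ E) :
    ∃ α ∈ E.insertNone, ∃ β ∈ E.insertNone, a ≤ endpoint α t ∧ endpoint β t ≤ b ∧
      SpansBelow N u w t (endpoint α t) (endpoint β t) := by
  have hnone : none ∈ E.insertNone := Finset.mem_insertNone.2 (by simp)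
  have hsome {e : ℝ} (he : e ∈ E) : some e ∈ E.insertNone := Finset.some_mem_insertNone.2 he
  obtain ⟨α, hα, hαmin⟩ := (E.insertNone.filter fun o => a ≤ endpoint o t).exists_min_image
    (fun o => endpoint o t) ⟨none, Finset.mem_filter.2 ⟨hnone, h.le_left⟩⟩
  obtain ⟨β, hβ, hβmax⟩ := (E.insertNone.filter fun o => endpoint o t ≤ b).exists_max_image
    (fun o => endpoint o t) ⟨none, Finset.mem_filter.2 ⟨hnone, h.left_le⟩⟩
  rw [Finset.mem_filter] at hα hβ
  have hmin (e : ℝ) (he : e ∈ E) (hae : a ≤ e) : endpoint α t ≤ e :=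
    hαmin (some e) (Finset.mem_filter.2 ⟨hsome he, hae⟩)
  have hmax (e : ℝ) (he : e ∈ E) (heb : e ≤ b) : e ≤ endpoint β t :=
    hβmax (some e) (Finset.mem_filter.2 ⟨hsome he, heb⟩)
  refine ⟨α, hα.1, β, hβ.1, hα.2, hβ.2,
    ⟨hαmin none (Finset.mem_filter.2 ⟨hnone, h.le_left⟩), hmin _ hw h.le_right,
    hβmax none (Finset.mem_filter.2 ⟨hnone, h.left_le⟩), hmax _ hw h.right_le, fun n hn hd => ?_⟩⟩
  obtain ⟨s, hs, has, hsb⟩ := h.meets n hn hd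
  exact ⟨s, hs, hmin s (hE n hn hs) has, hmax s (hE n hn hs) hsb⟩

/-- Whether symbolic endpoints are admissible depends only on the position of the height relative
to the finite set of fixed endpoints. -/
theorem SpansBelow.congr_height {N : ℕ} {u w : Strip} {t t' : ℝ} {E : Finset ℝ}
    (hw : (w.1 : ℝ) ∈ E) (hE : ∀ n < N, wormholeHeights (n + 1) ⊆ E)
    (htt' : ∀ e ∈ E, (e ≤ t ↔ e ≤ t') ∧ (t ≤ e ↔ t' ≤ e)) {α β : Option ℝ}
    (hα : α ∈ E.insertNone) (hβ : β ∈ E.insertNone)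
    (h : SpansBelow N u w t (endpoint α t) (endpoint β t)) :
    SpansBelow N u w t' (endpoint α t') (endpoint β t') := by
  have hle {o : Option ℝ} {e : ℝ} (ho : o ∈ E.insertNone) (he : e ∈ E)
      (hoe : endpoint o t ≤ e) : endpoint o t' ≤ e := by
    cases o with
    | none => exact (htt' e he).2.1 hoe
    | some f => exact hoe
  have hge {o : Option ℝ} {e : ℝ} (ho : o ∈ E.insertNone) (he : e ∈ E)
      (hoe : e ≤ endpoint o t) : e ≤ endpoint o t' := by
    cases o with
    | none => exact (htt' e he).1.1 hoe
    | some f => exact hoe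
  refine ⟨?_, hle hα hw h.le_right, ?_, hge hβ hw h.right_le, fun n hn hd => ?_⟩
  · cases α with
    | none => exact le_rfl
    | some f => exact (htt' f (by simpa using hα)).1.1 h.le_left
  · cases β with
    | none => exact le_rfl
    | some f => exact (htt' f (by simpa using hβ)).2.1 h.left_le
  · obtain ⟨s, hs, has, hsb⟩ := h.meets n hn hd
    exact ⟨s, hs, hle hα (hE n hn hs) has, hge hβ (hE n hn hs) hsb⟩

/-- Between sufficiently separated heights all wormhole levels of high order are available, so
that only finitely many digits matter. -/
theorem SpansBelow.spans {N : ℕ} {u v w : Strip} {a b : ℝ} (h : SpansBelow N u w v.1 a b)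
    (huv : ∀ n < N, digits v.2 n = digits u.2 n)
    (hN : ∀ n, N ≤ n → (2 : ℝ) / 3 ^ (n + 1) ≤ |(v.1 : ℝ) - w.1|) : Spans a b v w := by
  refine ⟨h.le_left, h.le_right, h.left_le, h.right_le, fun n hn => ?_⟩
  rcases lt_or_ge n N with hnN | hnN
  · exact h.meets n hnN (by rwa [← huv n hnN])
  · obtain ⟨s, hs, h1, h2⟩ := exists_wormhole_of_le (le_min v.1.2.1 w.1.2.1)
      (max_le v.1.2.2 w.1.2.2) (by rw [max_sub_min_eq_abs']; exact hN n hnN)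
    exact ⟨s, hs, (le_min h.le_left h.le_right).trans h1, h2.trans (max_le h.left_le h.right_le)⟩

theorem Spans.spansBelow {N : ℕ} {u v w : Strip} {a b : ℝ} (h : Spans a b v w)
    (huv : ∀ n < N, digits v.2 n = digits u.2 n) : SpansBelow N u w v.1 a b :=
  ⟨h.le_left, h.le_right, h.left_le, h.right_le,
    fun n hn hd => h.meets n (by rwa [huv n hn])⟩

/-- Points closer to `u` than all wormhole levels of order at most `N` have the same first `N`
digits as `u`. -/
theorem digits_eq_of_dist_lt {N : ℕ} {u v : Strip} {δ : ℝ}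
    (hδ : ∀ n < N, ∀ s ∈ wormholeHeights (n + 1), δ ≤ |s - u.1|)
    (huv : dist (proj v) (proj u) < δ) : ∀ n < N, digits v.2 n = digits u.2 n := by
  intro n hn
  by_contra hne
  obtain ⟨a, b, h, hlt⟩ := exists_spans_cost_lt v u (sub_pos.2 huv)
  obtain ⟨s, hs, has, hsb⟩ := h.meets n hne
  have h1 := hδ n hn s hs
  have h2 := h.sub_le_cost
  have h3 : |s - u.1| ≤ b - a :=
    abs_le.2 ⟨by linarith [h.right_le], by linarith [h.le_right]⟩
  linarith

/-- If the height of `x` is not a rational combination of `1` and the height of `p`, the distance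
from `p` is an affine function of the height near `x`. -/
theorem differentiableAt_of_notMem_exceptionalHeights {p x : Space}
    (hx : (height x : ℝ) ∉ exceptionalHeights (height p)) :
    DifferentiableAt (fun y => dist y p) x := by
  classical
  obtain ⟨w, rfl⟩ := proj_surjective p
  obtain ⟨u, rfl⟩ := proj_surjective x
  simp only [height_proj] at hx
  set q : ℝ := ((w.1 : I) : ℝ) with hq
  set t₀ : ℝ := ((u.1 : I) : ℝ) with ht₀
  have hne : t₀ ≠ q := fun h => hx (h ▸ self_mem_exceptionalHeights q)
  have hpos : 0 < |t₀ - q| / 2 := half_pos (abs_pos.2 (sub_ne_zero.2 hne))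
  obtain ⟨N, hN⟩ : ∃ N : ℕ, ∀ n, N ≤ n → (2 : ℝ) / 3 ^ (n + 1) ≤ |t₀ - q| / 2 :=
    Filter.eventually_atTop.1 (hasSum_weights.summable.tendsto_atTop_zero.eventually
      (ge_mem_nhds hpos))
  -- the possible endpoints, other than the varying height itself
  let E : Finset ℝ := insert q ((Finset.range N).biUnion fun n =>
    (wormholeHeights_finite (n + 1)).toFinset)
  have hwE : q ∈ E := Finset.mem_insert_self _ _
  have hE (n : ℕ) (hn : n < N) : wormholeHeights (n + 1) ⊆ E := fun s hs => by
    simp only [E, Finset.coe_insert, Finset.coe_biUnion]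
    exact Or.inr (by simpa using ⟨n, hn, hs⟩)
  have hEV (e : ℝ) (he : e ∈ E) : e ∈ exceptionalHeights q := by
    rcases Finset.mem_insert.1 he with rfl | he
    · exact self_mem_exceptionalHeights _
    · obtain ⟨n, -, hn⟩ := Finset.mem_biUnion.1 he
      exact wormholeHeights_subset_exceptionalHeights q n (by simpa using hn)
  -- the cost of a pair of symbolic endpoints is the affine function `c i + s i * t`
  let sgn : ℚ := if q < t₀ then 1 else -1
  let κ (o : Option ℝ) : ℚ := if o = none then 1 else 0
  let s (i : Option ℝ × Option ℝ) : ℚ := 2 * (κ i.2 - κ i.1) - sgn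
  let c (i : Option ℝ × Option ℝ) : ℝ := 2 * (endpoint i.2 0 - endpoint i.1 0) + sgn * q
  have hend (o : Option ℝ) (t : ℝ) : endpoint o t = endpoint o 0 + κ o * t := by
    cases o <;> simp [endpoint, κ]
  have hcost (i : Option ℝ × Option ℝ) (t : ℝ) : c i + s i * t =
      2 * (endpoint i.2 t - endpoint i.1 t) - sgn * (t - q) := by
    rw [hend i.2 t, hend i.1 t]
    simp only [c, s]
    push_cast
    ring
  let S : Finset (Option ℝ × Option ℝ) := (E.insertNone ×ˢ E.insertNone).filter fun i =>
    SpansBelow N u w t₀ (endpoint i.1 t₀) (endpoint i.2 t₀)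
  have hS {i : Option ℝ × Option ℝ} : i ∈ S ↔ (i.1 ∈ E.insertNone ∧ i.2 ∈ E.insertNone) ∧
      SpansBelow N u w t₀ (endpoint i.1 t₀) (endpoint i.2 t₀) := by
    simp only [S, Finset.mem_filter, Finset.mem_product]
  have hSne : S.Nonempty := by
    obtain ⟨α, hα, β, hβ, -, -, h⟩ := ((spans_zero_one u w).spansBelow
      (u := u) (fun n _ => rfl)).exists_endpoints hwE hE
    exact ⟨(α, β), hS.2 ⟨⟨hα, hβ⟩, h⟩⟩
  have hcV {i : Option ℝ × Option ℝ} (hi : i ∈ S) : c i ∈ exceptionalHeights q := by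
    have hV {o : Option ℝ} (ho : o ∈ E.insertNone) : endpoint o 0 ∈ exceptionalHeights q := by
      cases o with
      | none => exact zero_mem _
      | some e => exact hEV e (by simpa using ho)
    have h := add_mem ((exceptionalHeights q).smul_mem (2 : ℚ)
      (sub_mem (hV (hS.1 hi).1.2) (hV (hS.1 hi).1.1)))
      ((exceptionalHeights q).smul_mem sgn (self_mem_exceptionalHeights q))
    rw [Rat.smul_def, Rat.smul_def] at h
    simpa only [c, Rat.cast_ofNat] using h
  obtain ⟨i, hi, hmin⟩ := exists_eventually_forall_affine_le S hSne c (fun i => s i) t₀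
    (fun i hi j hj h => by
      by_contra hs
      have hs' : s i - s j ≠ 0 := sub_ne_zero.2 fun h => hs (by rw [h])
      refine hx (((exceptionalHeights q).smul_mem_iff hs').1 ?_)
      have h' : (s i - s j) • t₀ = c j - c i := by
        rw [Rat.smul_def]
        push_cast
        linarith
      rw [h']
      exact sub_mem (hcV hj) (hcV hi))
  have hpos_rel : ∀ᶠ t in 𝓝 t₀, ∀ e ∈ E, (e ≤ t₀ ↔ e ≤ t) ∧ (t₀ ≤ e ↔ t ≤ e) := by
    refine (Filter.eventually_all_finset E).2 fun e he => ?_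
    have hne : t₀ ≠ e := fun h => hx (h ▸ hEV e he)
    rcases hne.lt_or_gt with h | h
    · filter_upwards [gt_mem_nhds h] with t ht
      exact ⟨iff_of_false h.not_ge ht.not_ge, iff_of_true h.le ht.le⟩
    · filter_upwards [lt_mem_nhds h] with t ht
      exact ⟨iff_of_true h.le ht.le, iff_of_false h.not_ge ht.not_ge⟩
  obtain ⟨δ, hδ, hball⟩ := Metric.eventually_nhds_iff.1
    (hmin.and (hpos_rel.and (Metric.ball_mem_nhds t₀ hpos)))
  have hδE (e : ℝ) (he : e ∈ E) : δ ≤ |e - t₀| := by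
    by_contra! hlt
    have h := (hball (y := e) (by rwa [Real.dist_eq])).2.1 e he
    exact hx (le_antisymm (h.2.2 le_rfl) (h.1.2 le_rfl) ▸ hEV e he)
  -- near `x` the distance is the cost of the optimal pair `i`
  have key (v : Strip) (hv : dist (proj v) (proj u) < δ) :
      dist (proj v) (proj w) = c i + s i * v.1 := by
    have hvu : |(v.1 : ℝ) - t₀| < δ :=
      (abs_height_sub_le_dist (proj v) (proj u)).trans_lt hv
    obtain ⟨hmin', hrel, hvb⟩ := hball (y := (v.1 : ℝ)) (by rwa [Real.dist_eq])
    rw [Real.dist_eq] at hvb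
    have hd := digits_eq_of_dist_lt (N := N) (u := u) (v := v) (δ := δ)
      (fun n hn s hs => hδE s (hE n hn hs)) hv
    have hcost' (a b : ℝ) : cost a b v.1 w.1 = 2 * (b - a) - sgn * (v.1 - q) := by
      have hsgn : |(v.1 : ℝ) - q| = sgn * (v.1 - q) := by
        simp only [sgn]
        split_ifs with hlt
        · rw [abs_of_nonneg (sub_nonneg.2 ((hrel q hwE).1.1 hlt.le))]
          simp
        · rw [abs_of_nonpos (sub_nonpos.2 ((hrel q hwE).2.1 (not_lt.1 hlt)))]
          simp
      rw [cost, ← hsgn]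
    have hfar (n : ℕ) (hn : N ≤ n) : (2 : ℝ) / 3 ^ (n + 1) ≤ |(v.1 : ℝ) - w.1| := by
      have := abs_sub_le t₀ v.1 q
      rw [abs_sub_comm t₀ v.1] at this
      linarith [hN n hn]
    refine le_antisymm ?_ (le_of_forall_pos_lt_add fun ε hε => ?_)
    · have hi' := hS.1 hi
      have h := (SpansBelow.congr_height hwE hE hrel hi'.1.1 hi'.1.2 hi'.2).spans hd hfar
      rw [hcost, ← hcost']
      exact h.dist_le
    · obtain ⟨a, b, hab, hlt⟩ := exists_spans_cost_lt v w hε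
      obtain ⟨α, hα, β, hβ, haα, hβb, h⟩ := (hab.spansBelow hd).exists_endpoints hwE hE
      have h' := SpansBelow.congr_height hwE hE
        (fun e he => ⟨(hrel e he).1.symm, (hrel e he).2.symm⟩) hα hβ h
      have hle := hmin' (α, β) (hS.2 ⟨⟨hα, hβ⟩, h'⟩)
      rw [hcost (α, β)] at hle
      rw [hcost'] at hlt
      linarith
  have hself : dist (proj u) (proj u) < δ := by
    rw [dist_proj_same u.1 u.1 u.2]
    simpa using hδ
  refine ⟨s i, fun ε hε => ⟨δ, hδ, fun y _ hy => ?_⟩⟩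
  obtain ⟨v, rfl⟩ := proj_surjective y
  simp only [height_proj]
  rw [key v hy, key u hself]
  have : c i + s i * (v.1 : ℝ) - (c i + s i * (u.1 : ℝ)) - s i * ((v.1 : ℝ) - u.1) = 0 := by ring
  rw [this]
  simpa using hε

/-! ### Porosity of sets of constant height -/

/-- A vertical displacement of size `r` leads to a point at distance `r` from the whole level. -/
theorem isPorous_of_height_eq (t : I) {P : Set Space} (hP : ∀ x ∈ P, height x = t) :
    IsPorous dist P := by
  refine ⟨1 / 2, by norm_num, by norm_num, fun x hx δ hδ => ?_⟩
  obtain ⟨u, rfl⟩ := proj_surjective x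
  obtain ⟨s, hs0, hsδ⟩ : ∃ s : I, 0 < |(s : ℝ) - u.1| ∧ |(s : ℝ) - u.1| < δ := by
    have h0 := u.1.2.1
    have h1 := u.1.2.2
    have hr : 0 < min δ 1 / 2 := by positivity
    have hr1 : min δ 1 ≤ 1 := min_le_right _ _
    have hrδ : min δ 1 ≤ δ := min_le_left _ _
    rcases le_total (u.1 : ℝ) (1 / 2) with h | h
    · refine ⟨⟨u.1 + min δ 1 / 2, by linarith, by linarith⟩, ?_⟩
      simp only [add_sub_cancel_left]
      rw [abs_of_pos hr]
      exact ⟨hr, by linarith⟩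
    · refine ⟨⟨u.1 - min δ 1 / 2, by linarith, by linarith⟩, ?_⟩
      simp only [sub_sub_cancel_left]
      rw [abs_neg, abs_of_pos hr]
      exact ⟨hr, by linarith⟩
  have hd := dist_proj_same s u.1 u.2
  refine ⟨proj (s, u.2), by rwa [← hd] at hs0, by rwa [← hd] at hsδ,
    Set.eq_empty_of_forall_notMem ?_⟩
  rintro z ⟨hz, hzP⟩
  have hz' : dist z (proj (s, u.2)) < 1 / 2 * dist (proj (s, u.2)) (proj u) := hz
  rw [hd] at hz'
  have h := abs_height_sub_le_dist z (proj (s, u.2))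
  rw [hP z hzP, ← hP _ hx, height_proj, height_proj, abs_sub_comm] at h
  linarith

theorem isSigmaPorous_of_countable_height {P : Set Space} (h : (height '' P).Countable) :
    IsSigmaPorous dist P := by
  rcases P.eq_empty_or_nonempty with rfl | hne
  · exact ⟨fun _ => ∅, fun _ => isPorous_of_height_eq 0 (by simp), by simp⟩
  obtain ⟨f, hf⟩ := h.exists_eq_range (hne.image _)
  refine ⟨fun n => P ∩ {x | height x = f n}, fun n => isPorous_of_height_eq (f n) fun x hx => hx.2,
    ?_⟩
  rw [← Set.inter_iUnion]
  refine (Set.inter_eq_left.2 fun x hx => ?_).symm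
  obtain ⟨n, hn⟩ := hf ▸ Set.mem_image_of_mem height hx
  exact Set.mem_iUnion.2 ⟨n, hn.symm⟩

end Laakso

end

theorem theorem1p2 (p : Laakso.Space) :
    (Laakso.height '' Laakso.nonDiffSet p).Countable ∧
      Laakso.IsSigmaPorous Laakso.dist (Laakso.nonDiffSet p) := by
  have h : (Laakso.height '' Laakso.nonDiffSet p).Countable := by
    refine ((Laakso.countable_exceptionalHeights (Laakso.height p)).preimage
      Subtype.val_injective).mono ?_
    rintro _ ⟨x, hx, rfl⟩
    by_contra hmem
    exact hx (Laakso.differentiableAt_of_notMem_exceptionalHeights hmem)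
  exact ⟨h, Laakso.isSigmaPorous_of_countable_height h⟩
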